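/- Let $\sigma$ be a partition of the set of all primes (into non-empty blocks $\sigma_i$, $i\in I$) and let $G$ be a finite group. For a set $\pi$ of primes, a $\pi$-subgroup is a subgroup whose order has all its prime divisors in $\pi$; a Hall $\pi$-subgroup is a $\pi$-subgroup whose index is divisible by no prime of $\pi$; $O^{\pi}(G)$ is the intersection of all normal subgroups $N$ of $G$ such that $G/N$ is a $\pi$-group. A complete Hall $\sigma$-set of $G$ is a set $\mathcal H$ of subgroups of $G$ such that every member $\neq 1$ of $\mathcal H$ is a Hall $\sigma_i$-subgroup of $G$ for some $i$, and $\mathcal H$ contains exactly one Hall $\sigma_i$-subgroup of $G$ for every $i$ such that some prime of $\sigma_i$ divides $|G|$. The group $G$ is $\sigma$-full if it possesses a complete Hall $\sigma$-set, and $\sigma$-nilpotent if it is the direct product of the members of some complete Hall $\sigma$-set of $G$. A subgroup $A$ of $G$ is $\sigma$-permutable in $G$ if $G$ is $\sigma$-full and $AH=HA$ for every $i$ and every Hall $\sigma_i$-subgroup $H$ of $G$. If $G$ is $\sigma$-full, the $\sigma$-permutable subgroups of $G$, ordered by inclusion, form a lattice $\mathcal L_\sigma(G)$, whose join is the subgroup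 generated. An element $a$ of a lattice is meet-distributive if $a\wedge(b\vee c)=(a\wedge b)\vee(a\wedge c)$ for all $b,c$. For $\Omega\le G$ and subgroups $K\trianglelefteq H$ and $K\trianglelefteq L$ of $G$ with $K,H,L$ normalized by $\Omega$, the sections $H/K$ and $L/K$ are $\Omega$-isomorphic if there is a group isomorphism $f:H/K\to L/K$ with $f((hK)^a)=f(hK)^a$ for all $h\in H$, $a\in\Omega$, where $(hK)^a=(a^{-1}ha)K$. **Theorem A.** Suppose that $G$ is $\sigma$-full. Let $D$ be the $\sigma$-nilpotent residual of $G$, that is, the intersection of all normal subgroups $N$ of $G$ with $G/N$ $\sigma$-nilpotent, and let $\mathcal L=\mathcal L_\sigma(G)$. Then $\mathcal L$ is distributive if and only if the following conditions hold: (i) any two members of $\mathcal L$ permute, that is, $AB=BA$ for all $A,B\in\mathcal L$; (ii) the lattice of all normal subgroups of $G$ is distributive; (iii) $G/D$ is cyclic and $D$ is a meet-distributive element of $\mathcal L$; (iv) in every quotient $\bar G=G/R$ of $G$ by a normal subgroup $R$, for every $i$, any two $O^{\sigma_i}(\bar G)$-isomorphic sections $\bar H/\bar K$ and $\bar L/\bar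 K$, where $\bar K,\bar H,\bar L$ are $\sigma$-permutable $\sigma_i$-subgroups of $\bar G$, coincide, that is, $\bar H=\bar L$. Moreover, for sufficiency it is enough to require (iv) only for those $\bar H$ and $\bar L$ that cover $\bar K$ in the lattice $\mathcal L_\sigma(\bar G)$: if $G$ is $\sigma$-full and (i), (ii), (iii) and this weaker form of (iv) hold, then $\mathcal L$ is distributive. -/

import Mathlib

open scoped Pointwise

namespace SigmaGroup

/-! ### Generalities on subgroups and lattices -/

/-- Two subgroups `A` and `B` of `G` are permutable if `AB = BA` (as subsets of `G`). -/
def Permute {G : Type*} [Group G] (A B : Subgroup G) : Prop :=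
  (A : Set G) * (B : Set G) = (B : Set G) * (A : Set G)

/-- A lattice is distributive if `a ⊓ (b ⊔ c) = (a ⊓ b) ⊔ (a ⊓ c)` for all `a`, `b`, `c`. -/
def IsDistributive (L : Type*) [Lattice L] : Prop :=
  ∀ a b c : L, a ⊓ (b ⊔ c) = (a ⊓ b) ⊔ (a ⊓ c)

/-- An element `a` of a lattice is meet-distributive if `a ⊓ (b ⊔ c) = (a ⊓ b) ⊔ (a ⊓ c)`
for all `b`, `c`. -/
def IsMeetDistributive {L : Type*} [Lattice L] (a : L) : Prop :=
  ∀ b c : L, a ⊓ (b ⊔ c) = (a ⊓ b) ⊔ (a ⊓ c)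

/-- The set of all normal subgroups of `G`. -/
abbrev NormalSubgroups (G : Type*) [Group G] : Type _ :=
  {N : Subgroup G // N.Normal}

/-- The lattice of all normal subgroups of `G`: a sublattice of the lattice of all subgroups. -/
instance instLatticeNormalSubgroups (G : Type*) [Group G] : Lattice (NormalSubgroups G) :=
  Subtype.lattice
    (fun {A B} (hA : A.Normal) (hB : B.Normal) =>
      haveI := hA
      haveI := hB
      Subgroup.sup_normal A B)
    (fun {A B} (hA : A.Normal) (hB : B.Normal) =>
      haveI := hA
      haveI := hB
      Subgroup.normal_inf_normal A B)

/-! ### Hall subgroups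

A set of primes is a `Set Nat.Primes`. -/

/-- `n` is a `π`-number: every prime divisor of `n` lies in `π`. -/
def IsPiNumber (π : Set Nat.Primes) (n : ℕ) : Prop :=
  ∀ p : Nat.Primes, (p : ℕ) ∣ n → p ∈ π

/-- `H` is a `π`-subgroup: its order is a `π`-number. -/
def IsPiSubgroup {G : Type*} [Group G] (π : Set Nat.Primes) (H : Subgroup G) : Prop :=
  IsPiNumber π (Nat.card H)

/-- `H` is a Hall `π`-subgroup: its order is a `π`-number and its index is a `π'`-number. -/
def IsHall {G : Type*} [Group G] (π : Set Nat.Primes) (H : Subgroup G) : Prop :=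
  IsPiSubgroup π H ∧ IsPiNumber πᶜ H.index

/-- `O^π(G)`: the intersection of all normal subgroups of `G` whose quotient is a `π`-group. -/
def upperO {G : Type*} [Group G] (π : Set Nat.Primes) : Subgroup G :=
  sInf {N : Subgroup G | N.Normal ∧ IsPiNumber π N.index}

/-! ### Notions depending on a partition `σ` of the set of primes -/

/-- A complete Hall `σ`-set of `G`: every nontrivial member is a Hall `s`-subgroup for some block
`s` of `σ`, and for every block `s` containing a prime divisor of `|G|` there is exactly one
member that is a Hall `s`-subgroup. -/
def IsCompleteHallSet {G : Type*} [Group G] (σ : Set (Set Nat.Primes))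
    (𝓗 : Set (Subgroup G)) : Prop :=
  (∀ H ∈ 𝓗, H ≠ ⊥ → ∃ s ∈ σ, IsHall s H) ∧
  ∀ s ∈ σ, (∃ p ∈ s, (p : ℕ) ∣ Nat.card G) → ∃! H : Subgroup G, H ∈ 𝓗 ∧ IsHall s H

/-- `G` is `σ`-full if it possesses a complete Hall `σ`-set. -/
def IsFull (σ : Set (Set Nat.Primes)) (G : Type*) [Group G] : Prop :=
  ∃ 𝓗 : Set (Subgroup G), IsCompleteHallSet σ 𝓗

/-- `A` is `σ`-permutable in `G` if `G` is `σ`-full and `A` permutes with every Hall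
`s`-subgroup of `G`, for every block `s` of `σ`. -/
def IsPermutable {G : Type*} [Group G] (σ : Set (Set Nat.Primes)) (A : Subgroup G) : Prop :=
  IsFull σ G ∧ ∀ s ∈ σ, ∀ H : Subgroup G, IsHall s H → Permute A H

/-- `G` is `σ`-nilpotent if it is the (internal) direct product of the members of some
complete Hall `σ`-set of `G`. -/
def IsNilpotent (σ : Set (Set Nat.Primes)) (G : Type*) [Group G] : Prop :=
  ∃ 𝓗 : Set (Subgroup G), IsCompleteHallSet σ 𝓗 ∧
    (∀ H ∈ 𝓗, H.Normal) ∧ sSupIndep 𝓗 ∧ sSup 𝓗 = ⊤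

/-- The `σ`-nilpotent residual of `G`: the intersection of all normal subgroups `N` of `G` with
`σ`-nilpotent quotient `G ⧸ N`. -/
def residual (σ : Set (Set Nat.Primes)) (G : Type*) [Group G] : Subgroup G :=
  sInf {N : Subgroup G | ∃ _ : N.Normal, IsNilpotent σ (G ⧸ N)}

instance residual_normal (σ : Set (Set Nat.Primes)) (G : Type*) [Group G] :
    (residual σ G).Normal := by
  refine ⟨fun n hn g => ?_⟩
  rw [residual, Subgroup.mem_sInf] at hn ⊢
  intro N hN
  obtain ⟨h, _⟩ := id hN
  exact h.conj_mem n (hn N hN) g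

/-! ### The lattice of `σ`-permutable subgroups -/

/-- If every member of a set of subgroups permutes with `H`, so does the subgroup they generate. -/
theorem permute_sSup {G : Type*} [Group G] (S : Set (Subgroup G)) (H : Subgroup G)
    (hS : ∀ A ∈ S, Permute A H) : Permute (sSup S) H := by
  have key : ∀ x ∈ sSup S, ∀ h ∈ H, ∃ h' ∈ H, ∃ y ∈ sSup S, x * h = h' * y := by
    intro x hx
    rw [sSup_eq_iSup'] at hx
    refine Subgroup.iSup_induction
      (C := fun x => ∀ h ∈ H, ∃ h' ∈ H, ∃ y ∈ sSup S, x * h = h' * y) _ hx ?_ ?_ ?_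
    · rintro ⟨A, hA⟩ x hxA h hh
      have hmem : x * h ∈ (H : Set G) * (A : Set G) := by
        rw [← hS A hA]
        exact Set.mul_mem_mul hxA hh
      obtain ⟨h', hh', y, hy, e⟩ := hmem
      exact ⟨h', hh', y, le_sSup hA hy, e.symm⟩
    · intro h hh
      exact ⟨h, hh, 1, one_mem _, by simp⟩
    · intro x y hx hy h hh
      obtain ⟨h₁, hh₁, y₁, hy₁, e₁⟩ := hy h hh
      obtain ⟨h₂, hh₂, y₂, hy₂, e₂⟩ := hx h₁ hh₁
      exact ⟨h₂, hh₂, y₂ * y₁, mul_mem hy₂ hy₁, by rw [mul_assoc, e₁, ← mul_assoc, e₂, mul_assoc]⟩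
  apply Set.Subset.antisymm
  · rintro _ ⟨x, hx, h, hh, rfl⟩
    obtain ⟨h', hh', y, hy, e⟩ := key x hx h hh
    exact ⟨h', hh', y, hy, e.symm⟩
  · rintro _ ⟨h, hh, x, hx, rfl⟩
    obtain ⟨h', hh', y, hy, e⟩ := key x⁻¹ (inv_mem hx) h⁻¹ (inv_mem hh)
    refine ⟨y⁻¹, inv_mem hy, h'⁻¹, inv_mem hh', ?_⟩
    change y⁻¹ * h'⁻¹ = h * x
    rw [← mul_inv_rev, ← e, mul_inv_rev, inv_inv, inv_inv]

theorem isPermutable_sSup {G : Type*} [Group G] {σ : Set (Set Nat.Primes)} (hG : IsFull σ G)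
    (S : Set (Subgroup G)) (hS : ∀ A ∈ S, IsPermutable σ A) : IsPermutable σ (sSup S) :=
  ⟨hG, fun s hs H hH => permute_sSup S H fun A hA => (hS A hA).2 s hs H hH⟩

theorem isPermutable_sup {G : Type*} [Group G] {σ : Set (Set Nat.Primes)} {A B : Subgroup G}
    (hA : IsPermutable σ A) (hB : IsPermutable σ B) : IsPermutable σ (A ⊔ B) := by
  rw [← sSup_pair]
  refine isPermutable_sSup hA.1 _ ?_
  rintro C (rfl | rfl)
  · exact hA
  · exact hB

/-- The set of all `σ`-permutable subgroups of `G`, partially ordered by inclusion. -/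
abbrev PermutableSubgroups (σ : Set (Set Nat.Primes)) (G : Type*) [Group G] : Type _ :=
  {A : Subgroup G // IsPermutable σ A}

/-- The lattice of all `σ`-permutable subgroups of `G`, ordered by inclusion. The join of `A` and
`B` is the subgroup generated by `A` and `B`; the meet of `A` and `B` is their greatest lower bound
among the `σ`-permutable subgroups, that is, the join of all `σ`-permutable subgroups contained in
both. -/
instance instLatticePermutableSubgroups (σ : Set (Set Nat.Primes)) (G : Type*) [Group G] :
    Lattice (PermutableSubgroups σ G) where
  sup A B := ⟨A.1 ⊔ B.1, isPermutable_sup A.2 B.2⟩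
  le_sup_left A B := (le_sup_left : A.1 ≤ A.1 ⊔ B.1)
  le_sup_right A B := (le_sup_right : B.1 ≤ A.1 ⊔ B.1)
  sup_le A B C hA hB := (sup_le hA hB : A.1 ⊔ B.1 ≤ C.1)
  inf A B := ⟨sSup {C : Subgroup G | IsPermutable σ C ∧ C ≤ A.1 ∧ C ≤ B.1},
    isPermutable_sSup A.2.1 _ fun _ hC => hC.1⟩
  inf_le_left A _ := (sSup_le fun _ hC => hC.2.1 : sSup _ ≤ A.1)
  inf_le_right _ B := (sSup_le fun _ hC => hC.2.2 : sSup _ ≤ B.1)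
  le_inf A B C hB hC := (le_sSup (show A.1 ∈ {D : Subgroup G | IsPermutable σ D ∧ D ≤ B.1 ∧ D ≤ C.1}
    from ⟨A.2, hB, hC⟩) : A.1 ≤ sSup _)

/-! ### Operator isomorphisms of sections -/

/-- `H / K` is a section of `G` on which the subgroup `Ω` of `G` acts by conjugation: `K` is a
normal subgroup of `H`, and `Ω` normalizes both `H` and `K`. -/
structure IsOperatorSection {G : Type*} [Group G] (Ω H K : Subgroup G) : Prop where
  le : K ≤ H
  normal : (K.subgroupOf H).Normal
  normalizes_top : ∀ a ∈ Ω, ∀ h ∈ H, a⁻¹ * h * a ∈ H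
  normalizes_bot : ∀ a ∈ Ω, ∀ k ∈ K, a⁻¹ * k * a ∈ K

/-- The sections `H / K` and `L / K` of `G` are `Ω`-isomorphic: there is a group isomorphism
`f : H / K → L / K` commuting with the action `(hK)ᵃ = hᵃK` of the elements `a` of `Ω`, where
`hᵃ = a⁻¹ h a`. -/
def OperatorIsomorphic {G : Type*} [Group G] (Ω H L K : Subgroup G) : Prop :=
  ∃ (hH : IsOperatorSection Ω H K) (hL : IsOperatorSection Ω L K),
    haveI := hH.normal
    haveI := hL.normal
    ∃ f : (H ⧸ K.subgroupOf H) ≃* (L ⧸ K.subgroupOf L),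
      ∀ (a : G) (ha : a ∈ Ω) (h : H) (l : L),
        f (QuotientGroup.mk h) = QuotientGroup.mk l →
        f (QuotientGroup.mk ⟨a⁻¹ * h * a, hH.normalizes_top a ha h h.2⟩) =
          QuotientGroup.mk ⟨a⁻¹ * l * a, hL.normalizes_top a ha l l.2⟩

/-! ### The conditions -/

/-- Any two `σ`-permutable subgroups of `G` permute. -/
def ConditionI (σ : Set (Set Nat.Primes)) (G : Type*) [Group G] : Prop :=
  ∀ A B : PermutableSubgroups σ G, Permute A.1 B.1

/-- The lattice of normal subgroups of `G` is distributive. -/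
def ConditionII (G : Type*) [Group G] : Prop :=
  IsDistributive (NormalSubgroups G)

/-- With `D` the `σ`-nilpotent residual of `G`, the group `G ⧸ D` is cyclic and `D` is a
meet-distributive element of the lattice of `σ`-permutable subgroups of `G`. -/
def ConditionIII (σ : Set (Set Nat.Primes)) (G : Type*) [Group G] : Prop :=
  IsCyclic (G ⧸ residual σ G) ∧
  ∃ hD : IsPermutable σ (residual σ G),
    IsMeetDistributive (⟨residual σ G, hD⟩ : PermutableSubgroups σ G)

/-- In every quotient `Ḡ = G ⧸ R`, for every block `s` of `σ`, any two `O^s(Ḡ)`-isomorphic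
sections `H / K` and `L / K` with `K`, `H`, `L` being `σ`-permutable `s`-subgroups of `Ḡ`
coincide. -/
def ConditionIV (σ : Set (Set Nat.Primes)) (G : Type*) [Group G] : Prop :=
  ∀ (R : Subgroup G) [R.Normal], ∀ s ∈ σ, ∀ K H L : PermutableSubgroups σ (G ⧸ R),
    IsPiSubgroup s K.1 → IsPiSubgroup s H.1 → IsPiSubgroup s L.1 →
    OperatorIsomorphic (upperO s) H.1 L.1 K.1 → H = L

/-- The same condition, only for `H` and `L` that cover `K` in the lattice of `σ`-permutable
subgroups of `Ḡ`. -/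
def ConditionIVCovering (σ : Set (Set Nat.Primes)) (G : Type*) [Group G] : Prop :=
  ∀ (R : Subgroup G) [R.Normal], ∀ s ∈ σ, ∀ K H L : PermutableSubgroups σ (G ⧸ R),
    IsPiSubgroup s K.1 → IsPiSubgroup s H.1 → IsPiSubgroup s L.1 →
    K ⋖ H → K ⋖ L →
    OperatorIsomorphic (upperO s) H.1 L.1 K.1 → H = L

end SigmaGroup

/-!
Write `𝓛` for the lattice of `σ`-permutable subgroups of `G`. Its joins are joins of subgroups, but
its meets are intersections only once these are known to be `σ`-permutable. The latter holds for
permuting members `A` and `B`: if `S` is a Hall subgroup permuting with both, counting gives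
`S ∩ AB = (S ∩ A)(S ∩ B)`, whence `(A ∩ B)S = AS ∩ BS` (`Permute.inf_hall`).

*A distributive lattice satisfies the conditions.* In a distributive lattice relative complements
are unique, and `𝓛` is closed under conjugation. Hence an element of `G` normalizing a member of `𝓛`
and the ends of an interval around it normalizes its relative complement in that interval.
* Two members `A`, `B` permute by induction on `|A|`: the join `M` of the `A`-conjugates of the
  meet of `A` and `B` permutes with `B`, and `A` normalizes `BM` (`permute_of_isDistributive`).
* The normal subgroups form a sublattice of `𝓛`. All subgroups containing the `σ`-nilpotent
  residual `D` belong to `𝓛`, because `HD` is normal for each Hall `s`-subgroup `H`; so `G / D` has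
  distributive subgroup lattice and is cyclic by Ore's theorem (`isCyclic_of_isDistributive`).
* If `H / K` and `L / K` are `O^s(G)`-isomorphic sections of `σ`-permutable `s`-subgroups, then by
  induction the isomorphism stabilizes the section of `H ∩ L`, and `H` and `L` normalize each other.
  The graph of the isomorphism then yields a diagonal subgroup, a relative complement of `H` besides
  `L`; it is `σ`-permutable since `O^s(G)` normalizes it. So it equals `L`, and `H = L`
  (`eq_of_isIsoGraph`).

*The conditions imply distributivity.* If the members of `𝓛` permute, then `𝓛` is modular with
intersections as meets, and each member is normal in its covers. If `𝓛` is not distributive, it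
contains a diamond `K < H, L, M < V` with `H`, `L`, `M` covering `K` (`exists_diamond`). After
dividing by the normal core of `K`, that core is trivial. The key fact is that members of `𝓛` are
`σ`-nilpotent modulo their normal cores (`PermutingLattice.commutator_mem_normalCore`). It rests on
subnormality: a Hall `t`-subgroup `T` normalizes the subgroup `O^t(A)` generated by the `t'`-elements
of `A`, since `A` contains all `t'`-elements of `AT`. As `V / K` is abelian, one deduces that
`V = K (V ∩ O_s(G))` for some block `s` (`IsDiamond.exists_block_of_core_eq_bot`). Intersecting with
`Q = V ∩ O_s(G)` gives a diamond of `s`-subgroups. Its atoms `H ∩ Q` and `L ∩ Q` are distinct, cover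
its bottom, and are both complements of `M ∩ Q`, hence `O^s(G)`-isomorphic modulo `K ∩ Q`. This
contradicts the condition on operator isomorphic sections.

The passage to quotients is organized by the structure `PermutingLattice`, which records only those
properties of `𝓛` and of the Hall subgroups of `G` that quotients inherit. In this way no lifting of
Hall subgroups of `G / R` to `G` is required.
-/

namespace SigmaGroup

/-! ### Permuting subgroups -/

section Permute

variable {G : Type*} [Group G] {A B C H : Subgroup G}

theorem Permute.symm (h : Permute A B) : Permute B A := Eq.symm h

theorem permute_iff : Permute A B ↔ ∀ a ∈ A, ∀ b ∈ B, ∃ b' ∈ B, ∃ a' ∈ A, a * b = b' * a' := by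
  constructor
  · intro h a ha b hb
    have hm : a * b ∈ (B : Set G) * (A : Set G) := h ▸ Set.mul_mem_mul ha hb
    obtain ⟨b', hb', a', ha', e⟩ := hm
    exact ⟨b', hb', a', ha', e.symm⟩
  · intro h
    apply Set.Subset.antisymm
    · rintro _ ⟨a, ha, b, hb, rfl⟩
      obtain ⟨b', hb', a', ha', e⟩ := h a ha b hb
      exact ⟨b', hb', a', ha', e.symm⟩
    · rintro _ ⟨b, hb, a, ha, rfl⟩
      obtain ⟨b', hb', a', ha', e⟩ := h a⁻¹ (inv_mem ha) b⁻¹ (inv_mem hb)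
      refine ⟨a'⁻¹, inv_mem ha', b'⁻¹, inv_mem hb', ?_⟩
      change a'⁻¹ * b'⁻¹ = b * a
      rw [← mul_inv_rev, ← e, mul_inv_rev, inv_inv, inv_inv]

theorem permute_of_le (h : A ≤ B) : Permute A B :=
  permute_iff.2 fun a ha b hb => ⟨a * b, mul_mem (h ha) hb, 1, one_mem _, by simp⟩

theorem permute_of_le_normalizer (h : B ≤ Subgroup.normalizer (A : Set G)) : Permute A B :=
  permute_iff.2 fun a ha b hb => ⟨b, hb, b⁻¹ * a * b, by
    simpa using (Subgroup.mem_normalizer_iff.1 (inv_mem (h hb)) a).1 ha, by group⟩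

theorem permute_of_normal [A.Normal] : Permute A B :=
  permute_of_le_normalizer (by rw [Subgroup.normalizer_eq_top]; exact le_top)

/-- If `A` and `B` permute, then `A ⊔ B` is the set of all products `ab`. -/
theorem Permute.exists_of_mem_sup (h : Permute A B) {x : G} (hx : x ∈ A ⊔ B) :
    ∃ a ∈ A, ∃ b ∈ B, x = a * b := by
  have h' := permute_iff.1 h.symm
  let P : Subgroup G :=
    { carrier := {x | ∃ a ∈ A, ∃ b ∈ B, x = a * b}
      one_mem' := ⟨1, one_mem _, 1, one_mem _, by simp⟩
      mul_mem' := by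
        rintro _ _ ⟨a, ha, b, hb, rfl⟩ ⟨a₁, ha₁, b₁, hb₁, rfl⟩
        obtain ⟨a₂, ha₂, b₂, hb₂, e⟩ := h' b hb a₁ ha₁
        refine ⟨a * a₂, mul_mem ha ha₂, b₂ * b₁, mul_mem hb₂ hb₁, ?_⟩
        rw [mul_assoc, ← mul_assoc b, e]
        group
      inv_mem' := by
        rintro _ ⟨a, ha, b, hb, rfl⟩
        obtain ⟨a₂, ha₂, b₂, hb₂, e⟩ := h' b⁻¹ (inv_mem hb) a⁻¹ (inv_mem ha)
        exact ⟨a₂, ha₂, b₂, hb₂, by rw [mul_inv_rev, e]⟩ }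
  have hP : A ⊔ B ≤ P := sup_le (fun a ha => ⟨a, ha, 1, one_mem _, by simp⟩)
    fun b hb => ⟨1, one_mem _, b, hb, by simp⟩
  exact hP hx

/-- If the set `AB` is a subgroup, then `A` and `B` permute. -/
theorem permute_of_forall_mem_sup (h : ∀ x ∈ A ⊔ B, ∃ a ∈ A, ∃ b ∈ B, x = a * b) :
    Permute A B := by
  refine Permute.symm (permute_iff.2 fun b hb a ha => ?_)
  obtain ⟨a', ha', b', hb', e⟩ := h (b * a)
    (mul_mem (Subgroup.mem_sup_right hb) (Subgroup.mem_sup_left ha))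
  exact ⟨a', ha', b', hb', e⟩

/-- The modular law for permuting subgroups. -/
theorem Permute.sup_inf_le (h : Permute A B) (hAC : A ≤ C) : (A ⊔ B) ⊓ C ≤ A ⊔ (B ⊓ C) := by
  intro x hx
  obtain ⟨a, ha, b, hb, rfl⟩ := h.exists_of_mem_sup hx.1
  have hbC : b ∈ C := by simpa using mul_mem (inv_mem (hAC ha)) hx.2
  exact mul_mem (Subgroup.mem_sup_left ha) (Subgroup.mem_sup_right ⟨hb, hbC⟩)

theorem Permute.map {G' : Type*} [Group G'] (f : G →* G') (h : Permute A B) :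
    Permute (A.map f) (B.map f) := by
  unfold Permute at h ⊢
  simp only [Subgroup.coe_map, ← Set.image_mul, h]

/-- The preimage of `A` contains the kernel, so it suffices that `A` permutes with the image. -/
theorem permute_comap_of_permute_map {G' : Type*} [Group G'] (f : G →* G')
    {A : Subgroup G'} {H : Subgroup G} (h : Permute A (H.map f)) :
    Permute (A.comap f) H := by
  refine permute_iff.2 fun a ha b hb => ?_
  obtain ⟨_, ⟨b', hb', rfl⟩, a', ha', e⟩ :=
    permute_iff.1 h (f a) ha (f b) (Subgroup.mem_map_of_mem f hb)
  refine ⟨b', hb', b'⁻¹ * (a * b), ?_, by group⟩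
  rw [Subgroup.mem_comap, map_mul, map_mul, e, map_inv, inv_mul_cancel_left]
  exact ha'

theorem Permute.smul (h : Permute A B) (g : G) :
    Permute (MulAut.conj g • A) (MulAut.conj g • B) :=
  h.map _

theorem mem_conj_smul {g x : G} : x ∈ MulAut.conj g • A ↔ g⁻¹ * x * g ∈ A := by
  rw [Subgroup.mem_pointwise_smul_iff_inv_smul_mem, ← map_inv, MulAut.smul_def,
    MulAut.conj_apply, inv_inv]

/-- `|AB : B| = |A : A ∩ B|`. -/
theorem Permute.relIndex_sup (h : Permute A B) : B.relIndex (A ⊔ B) = B.relIndex A := by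
  refine (Nat.card_congr (Equiv.ofBijective
    (Subgroup.quotientSubgroupOfEmbeddingOfLE B (le_sup_left : A ≤ A ⊔ B)) ⟨?_, ?_⟩)).symm
  · exact (Subgroup.quotientSubgroupOfEmbeddingOfLE B (le_sup_left : A ≤ A ⊔ B)).injective
  · intro x
    obtain ⟨⟨x, hx⟩, rfl⟩ := QuotientGroup.mk_surjective x
    obtain ⟨a, ha, b, hb, e⟩ := h.exists_of_mem_sup hx
    refine ⟨QuotientGroup.mk ⟨a, ha⟩, ?_⟩
    rw [Subgroup.quotientSubgroupOfEmbeddingOfLE_apply_mk, QuotientGroup.eq,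
      Subgroup.mem_subgroupOf]
    simpa [e] using hb

theorem le_normalizer_of_forall (h : ∀ b ∈ B, ∀ a ∈ A, b * a * b⁻¹ ∈ A) :
    B ≤ Subgroup.normalizer (A : Set G) := fun b hb =>
  Subgroup.mem_normalizer_iff.2 fun a => ⟨h b hb a, fun ha => by
    have := h b⁻¹ (inv_mem hb) _ ha
    simpa [mul_assoc] using this⟩

theorem conj_mem_of_mem_normalizer {g a : G} (hg : g ∈ Subgroup.normalizer (A : Set G))
    (ha : a ∈ A) : g * a * g⁻¹ ∈ A :=
  (Subgroup.mem_normalizer_iff.1 hg a).1 ha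

theorem le_normalizer_inf (hA : C ≤ Subgroup.normalizer (A : Set G))
    (hB : C ≤ Subgroup.normalizer (B : Set G)) :
    C ≤ Subgroup.normalizer ((A ⊓ B : Subgroup G) : Set G) :=
  le_normalizer_of_forall fun _ hc _ ha =>
    ⟨conj_mem_of_mem_normalizer (hA hc) ha.1, conj_mem_of_mem_normalizer (hB hc) ha.2⟩

theorem le_normalizer_of_normal [A.Normal] : C ≤ Subgroup.normalizer (A : Set G) := by
  rw [Subgroup.normalizer_eq_top]; exact le_top

end Permute

/-! ### Numbers and elements with prescribed prime divisors -/

section PiNumber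

variable {π : Set Nat.Primes} {m n : ℕ}

theorem IsPiNumber.of_dvd (h : IsPiNumber π n) (hmn : m ∣ n) : IsPiNumber π m :=
  fun p hp => h p (hp.trans hmn)

theorem IsPiNumber.mul (hm : IsPiNumber π m) (hn : IsPiNumber π n) : IsPiNumber π (m * n) :=
  fun p hp => ((Nat.Prime.dvd_mul p.2).1 hp).elim (hm p) (hn p)

theorem isPiNumber_one : IsPiNumber π 1 :=
  fun p hp => absurd (Nat.dvd_one.1 hp) p.2.one_lt.ne'

theorem IsPiNumber.mono {π' : Set Nat.Primes} (h : IsPiNumber π n) (hπ : π ⊆ π') :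
    IsPiNumber π' n := fun p hp => hπ (h p hp)

theorem IsPiNumber.coprime (hm : IsPiNumber π m) (hn : IsPiNumber πᶜ n) : Nat.Coprime m n := by
  refine Nat.Coprime.symm (Nat.coprime_of_dvd fun p hp h1 h2 => ?_)
  exact hn ⟨p, hp⟩ h1 (hm ⟨p, hp⟩ h2)

theorem IsPiNumber.eq_one (hm : IsPiNumber π m) (hn : IsPiNumber πᶜ m) : m = 1 :=
  (Nat.coprime_self m).1 (hm.coprime hn)

/-- `IsPiNumber π n` for `n = p ^ k` with `p` a prime in `π`. -/
theorem isPiNumber_prime_pow {p : Nat.Primes} (hp : p ∈ π) (k : ℕ) :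
    IsPiNumber π ((p : ℕ) ^ k) := fun q hq => by
  have : q = p := Subtype.ext ((Nat.prime_dvd_prime_iff_eq q.2 p.2).1 (q.2.dvd_of_dvd_pow hq))
  exact this ▸ hp

end PiNumber

section Elements

variable {G : Type*} [Group G] {π : Set Nat.Primes} {A B S Z : Subgroup G}

theorem orderOf_conj (g x : G) : orderOf (g * x * g⁻¹) = orderOf x := by
  simpa using (MulEquiv.orderOf_eq (MulAut.conj g) x)

theorem IsPiSubgroup.mono (h : IsPiSubgroup π B) (hAB : A ≤ B) : IsPiSubgroup π A :=
  IsPiNumber.of_dvd h (Subgroup.card_dvd_of_le hAB)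

theorem IsPiSubgroup.orderOf (h : IsPiSubgroup π A) {x : G} (hx : x ∈ A) :
    IsPiNumber π (orderOf x) :=
  IsPiNumber.of_dvd h (Subgroup.orderOf_dvd_natCard A hx)

theorem card_conj_smul (g : G) (A : Subgroup G) :
    Nat.card (MulAut.conj g • A : Subgroup G) = Nat.card A :=
  (Nat.card_congr (Subgroup.equivSMul (MulAut.conj g) A).toEquiv).symm

theorem IsPiSubgroup.smul (h : IsPiSubgroup π A) (g : G) :
    IsPiSubgroup π (MulAut.conj g • A) := by
  unfold IsPiSubgroup
  rw [card_conj_smul]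
  exact h

/-- If `S ∩ A` is normal in `A`, it contains the elements of `A` of order prime to its index. -/
theorem mem_of_coprime_relIndex (hS : A ≤ Subgroup.normalizer ((S ⊓ A : Subgroup G) : Set G))
    {x : G} (hx : x ∈ A) (h : Nat.Coprime (orderOf x) (S.relIndex A)) : x ∈ S := by
  have hn : (S.subgroupOf A).Normal := by
    refine ⟨fun a ha g => ?_⟩
    exact (conj_mem_of_mem_normalizer (hS g.2) (a := (a : G)) ⟨ha, a.2⟩).1
  have h1 : (⟨x, hx⟩ : A) ^ S.relIndex A ∈ S.subgroupOf A := Subgroup.pow_index_mem _ _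
  have h2 : x ^ S.relIndex A ∈ S := h1
  have h3 : x ^ (orderOf x) ∈ S := by rw [pow_orderOf_eq_one]; exact one_mem _
  have h4 := Nat.gcd_eq_gcd_ab (orderOf x) (S.relIndex A)
  rw [h, Nat.cast_one] at h4
  have h5 : x = (x ^ orderOf x) ^ (Nat.gcdA (orderOf x) (S.relIndex A)) *
      (x ^ S.relIndex A) ^ (Nat.gcdB (orderOf x) (S.relIndex A)) := by
    rw [← zpow_natCast, ← zpow_natCast, ← zpow_mul, ← zpow_mul, ← zpow_add, ← h4, zpow_one]
  rw [h5]
  exact mul_mem (zpow_mem h3 _) (zpow_mem h2 _)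

/-- A Hall `π`-subgroup `S ∩ A` of `A` that is normal in `A` contains all `π`-elements of `A`. -/
theorem mem_of_normal_hall (hS : A ≤ Subgroup.normalizer ((S ⊓ A : Subgroup G) : Set G))
    (hi : IsPiNumber πᶜ (S.relIndex A))
    {x : G} (hx : x ∈ A) (h : IsPiNumber π (orderOf x)) : x ∈ S :=
  mem_of_coprime_relIndex hS hx (h.coprime hi)

/-- A `π`-subgroup of `A` normalized by `S ∩ A` is contained in `S` if `S ∩ A` has
`π'`-index in `A`. -/
theorem le_of_isPiSubgroup [Finite G] {U : Subgroup G} (hU : IsPiSubgroup π U) (hUA : U ≤ A)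
    (hn : S ⊓ A ≤ Subgroup.normalizer (U : Set G)) (hi : IsPiNumber πᶜ (S.relIndex A)) :
    U ≤ S := by
  have hp : Permute U (S ⊓ A) := permute_of_le_normalizer hn
  have h1 : (S ⊓ A).relIndex U ∣ S.relIndex A := by
    rw [← hp.relIndex_sup, ← Subgroup.inf_relIndex_right S A,
      ← Subgroup.relIndex_mul_relIndex _ _ _ le_sup_right (sup_le hUA inf_le_right)]
    exact dvd_mul_right _ _
  have h2 : (S ⊓ A).relIndex U = 1 :=
    IsPiNumber.eq_one (IsPiNumber.of_dvd hU (Subgroup.relIndex_dvd_card _ _)) (hi.of_dvd h1)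
  exact (Subgroup.relIndex_eq_one.1 h2).trans inf_le_left

/-- If `Z` contains all `p`-elements of `A`, then `p` does not divide `|A : A ∩ Z|`. -/
theorem not_dvd_relIndex [Finite G] {p : ℕ} (hp : p.Prime)
    (h : ∀ x ∈ A, ∀ k, orderOf x = p ^ k → x ∈ Z) : ¬ p ∣ Z.relIndex A := by
  have := Fact.mk hp
  obtain ⟨P⟩ : Nonempty (Sylow p A) := inferInstance
  have hPZ : (P : Subgroup A) ≤ Z.subgroupOf A := fun x hx => by
    obtain ⟨k, hk⟩ := IsPGroup.iff_orderOf.1 P.isPGroup' ⟨x, hx⟩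
    rw [Subgroup.orderOf_mk] at hk
    exact h x x.2 k (by rw [Subgroup.orderOf_coe]; exact hk)
  exact fun hd => P.not_dvd_index (hd.trans (Subgroup.index_dvd_of_le hPZ))

/-- If `Z` contains all `π'`-elements of `A`, then `|A : A ∩ Z|` is a `π`-number. -/
theorem isPiNumber_relIndex [Finite G]
    (h : ∀ x ∈ A, IsPiNumber πᶜ (orderOf x) → x ∈ Z) : IsPiNumber π (Z.relIndex A) := by
  intro p hp
  by_contra hpπ
  refine not_dvd_relIndex p.2 (fun x hx k hk => h x hx ?_) hp
  rw [hk]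
  exact isPiNumber_prime_pow (π := πᶜ) hpπ k

theorem eq_one_of_forall_not_dvd {n : ℕ} (h : ∀ p : Nat.Primes, ¬ (p : ℕ) ∣ n) : n = 1 := by
  by_contra hn
  obtain ⟨p, hp, hd⟩ := Nat.exists_prime_and_dvd hn
  exact h ⟨p, hp⟩ hd

end Elements

/-! ### Hall subgroups and `σ`-permutable subgroups -/

section Hall

variable {G : Type*} [Group G] {π : Set Nat.Primes} {A B S H : Subgroup G}

theorem IsHall.smul (h : IsHall π H) (g : G) : IsHall π (MulAut.conj g • H) := by
  refine ⟨h.1.smul g, ?_⟩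
  have : (MulAut.conj g • H).index = H.index :=
    Subgroup.index_map_of_bijective (MulAut.conj g).bijective H
  rw [this]
  exact h.2

theorem IsHall.map {G' : Type*} [Group G'] {f : G →* G'} (hf : Function.Surjective f)
    (h : IsHall π H) : IsHall π (H.map f) :=
  ⟨IsPiNumber.of_dvd h.1 (Subgroup.card_map_dvd H f), h.2.of_dvd (Subgroup.index_map_dvd H hf)⟩

/-- If a Hall `π`-subgroup `H` permutes with `A`, then `A ∩ H` is a Hall `π`-subgroup of `A`. -/
theorem IsHall.relIndex (h : IsHall π H) (hp : Permute A H) :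
    IsPiNumber πᶜ (H.relIndex A) := by
  rw [← hp.relIndex_sup]
  exact h.2.of_dvd (Subgroup.relIndex_dvd_index_of_le le_sup_right)

theorem IsHall.relIndex_of_normal (h : IsHall π H) (A : Subgroup G) [A.Normal] :
    IsPiNumber πᶜ (H.relIndex A) :=
  h.relIndex permute_of_normal

/-- A normal `π`-subgroup is contained in every Hall `π`-subgroup. -/
theorem IsHall.le_of_normal [Finite G] (h : IsHall π H) [A.Normal] (hA : IsPiSubgroup π A) :
    A ≤ H :=
  le_of_isPiSubgroup (A := A) (S := H) hA le_rfl le_normalizer_of_normal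
    (h.relIndex_of_normal A)

/-- A `π`-subgroup permuting with a Hall `π`-subgroup is contained in it. -/
theorem IsHall.le_of_permute (h : IsHall π H) (hA : IsPiSubgroup π A)
    (hp : Permute A H) : A ≤ H :=
  Subgroup.relIndex_eq_one.1 (IsPiNumber.eq_one
    (IsPiNumber.of_dvd hA (Subgroup.relIndex_dvd_card _ _)) (h.relIndex hp))

/-- A normal Hall `π`-subgroup contains every `π`-subgroup. -/
theorem IsHall.le_of_isPiSubgroup (h : IsHall π H) [H.Normal] (hA : IsPiSubgroup π A) :
    A ≤ H :=
  h.le_of_permute hA permute_of_normal.symm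

theorem isHall_bot (h : IsPiNumber πᶜ (Nat.card G)) : IsHall π (⊥ : Subgroup G) := by
  refine ⟨?_, by rwa [Subgroup.index_bot]⟩
  unfold IsPiSubgroup
  rw [Subgroup.card_bot]
  exact isPiNumber_one

/-- If `S` meets `A`, `B` and `AB` in Hall `π`-subgroups, then
`S ∩ AB = (S ∩ A)(S ∩ B)`. -/
theorem Permute.exists_of_mem_hall [Finite G] (h : Permute A B) (hS : IsPiSubgroup π S)
    (hSA : IsPiNumber πᶜ (S.relIndex A)) (hSB : IsPiNumber πᶜ (S.relIndex B))
    {x : G} (hxS : x ∈ S) (hx : x ∈ A ⊔ B) :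
    ∃ a ∈ S ⊓ A, ∃ b ∈ S ⊓ B, x = a * b := by
  have hle : S ⊓ A ≤ S ⊓ (A ⊔ B) := inf_le_inf_left _ le_sup_left
  have hij : B.relIndex (S ⊓ (A ⊔ B)) ∣ B.relIndex (S ⊓ A) := by
    have e1 : B.relIndex (S ⊓ (A ⊔ B)) * S.relIndex (A ⊔ B) = B.relIndex A * S.relIndex B := by
      rw [Subgroup.relIndex_inf_mul_relIndex, inf_comm, ← Subgroup.relIndex_inf_mul_relIndex,
        inf_eq_left.2 (le_sup_right : B ≤ A ⊔ B), h.relIndex_sup, mul_comm]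
    have e2 : B.relIndex (S ⊓ A) * S.relIndex A = S.relIndex (B ⊓ A) * B.relIndex A := by
      rw [Subgroup.relIndex_inf_mul_relIndex, inf_comm, ← Subgroup.relIndex_inf_mul_relIndex]
    have hj : IsPiNumber π (B.relIndex (S ⊓ (A ⊔ B))) :=
      IsPiNumber.of_dvd hS ((Subgroup.relIndex_dvd_card _ _).trans
        (Subgroup.card_dvd_of_le inf_le_left))
    have hd : B.relIndex (S ⊓ (A ⊔ B)) ∣ B.relIndex (S ⊓ A) * (S.relIndex A * S.relIndex B) := by
      rw [← mul_assoc, e2, mul_assoc, ← e1]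
      exact (dvd_mul_right _ _).mul_left _
    exact (hj.coprime (hSA.mul hSB)).dvd_of_dvd_mul_right hd
  have hinj := (Subgroup.quotientSubgroupOfEmbeddingOfLE B hle).injective
  have hcard : Nat.card (↥(S ⊓ (A ⊔ B)) ⧸ B.subgroupOf (S ⊓ (A ⊔ B))) ≤
      Nat.card (↥(S ⊓ A) ⧸ B.subgroupOf (S ⊓ A)) :=
    Nat.le_of_dvd Nat.card_pos hij
  obtain ⟨y, hy⟩ := (hinj.bijective_of_nat_card_le hcard).2
    (QuotientGroup.mk ⟨x, hxS, hx⟩)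
  obtain ⟨⟨a, ha⟩, rfl⟩ := QuotientGroup.mk_surjective y
  rw [Subgroup.quotientSubgroupOfEmbeddingOfLE_apply_mk, QuotientGroup.eq,
    Subgroup.mem_subgroupOf] at hy
  have hb : a⁻¹ * x ∈ B := by simpa using hy
  exact ⟨a, ha, a⁻¹ * x, ⟨S.mul_mem (S.inv_mem ha.1) hxS, hb⟩, by group⟩

/-- If `A` and `B` permute with each other and with a Hall `π`-subgroup `S`, then
`(A ∩ B)S = AS ∩ BS`, so that `A ∩ B` permutes with `S`. -/
theorem Permute.inf_hall [Finite G] (h : Permute A B) (hS : IsHall π S)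
    (hA : Permute A S) (hB : Permute B S) : Permute (A ⊓ B) S := by
  refine permute_of_forall_mem_sup fun x hx => ?_
  obtain ⟨a, ha, s, hs, ea⟩ := hA.exists_of_mem_sup (sup_le_sup_right inf_le_left S hx)
  obtain ⟨b, hb, t, ht, eb⟩ := hB.exists_of_mem_sup (sup_le_sup_right inf_le_right S hx)
  -- `a⁻¹ b = s t⁻¹` lies in `S ∩ AB`
  have e : a⁻¹ * b = s * t⁻¹ := by
    rw [eq_mul_inv_iff_mul_eq, mul_assoc, ← eb, ea, inv_mul_cancel_left]
  obtain ⟨a₀, ha₀, b₀, hb₀, e₀⟩ := h.exists_of_mem_hall hS.1 (hS.relIndex hA) (hS.relIndex hB)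
    (x := a⁻¹ * b) (e ▸ mul_mem hs (inv_mem ht))
    (mul_mem (Subgroup.mem_sup_left (inv_mem ha)) (Subgroup.mem_sup_right hb))
  have e' : a * a₀ = b * b₀⁻¹ := by
    rw [eq_mul_inv_iff_mul_eq, mul_assoc, ← e₀, mul_inv_cancel_left]
  exact ⟨a * a₀, ⟨mul_mem ha ha₀.2, e' ▸ B.mul_mem hb (B.inv_mem hb₀.2)⟩, a₀⁻¹ * s,
    S.mul_mem (S.inv_mem ha₀.1) hs, by rw [ea]; group⟩

end Hall

section Full

variable {G : Type*} [Group G] {σ : Set (Set Nat.Primes)} {A B H : Subgroup G}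

theorem exists_block (hσ : Setoid.IsPartition σ) (p : Nat.Primes) : ∃ s ∈ σ, p ∈ s := by
  obtain ⟨s, hs, -⟩ := hσ.2 p
  exact ⟨s, hs.1, hs.2⟩

theorem block_subset_compl (hσ : Setoid.IsPartition σ) {s t : Set Nat.Primes} (hs : s ∈ σ)
    (ht : t ∈ σ) (hst : s ≠ t) : t ⊆ sᶜ := fun p hpt hps =>
  hst ((hσ.2 p).unique ⟨hs, hps⟩ ⟨ht, hpt⟩)

/-- For a block `s` without prime divisors of `|G|` the Hall `s`-subgroup is trivial; a complete Hall
`σ`-set need not contain it. -/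
theorem IsFull.exists_isHall (h : IsFull σ G) {s : Set Nat.Primes} (hs : s ∈ σ) :
    ∃ H : Subgroup G, IsHall s H := by
  obtain ⟨𝓗, h𝓗⟩ := h
  by_cases hp : ∃ p ∈ s, (p : ℕ) ∣ Nat.card G
  · obtain ⟨H, hH, -⟩ := h𝓗.2 s hs hp
    exact ⟨H, hH.2⟩
  · exact ⟨⊥, isHall_bot fun p hpG hps => hp ⟨p, hps, hpG⟩⟩

theorem isFull_of_exists_isHall (hσ : Setoid.IsPartition σ)
    (h : ∀ s ∈ σ, ∃ H : Subgroup G, IsHall s H) : IsFull σ G := by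
  choose! S hS using h
  refine ⟨S '' σ, ?_, ?_⟩
  · rintro _ ⟨s, hs, rfl⟩ -
    exact ⟨s, hs, hS s hs⟩
  · rintro s hs ⟨p, hps, hpG⟩
    refine ⟨S s, ⟨⟨s, hs, rfl⟩, hS s hs⟩, ?_⟩
    rintro _ ⟨⟨t, ht, rfl⟩, hSt⟩
    by_contra hne
    have hst : s ≠ t := fun e => hne (e ▸ rfl)
    have hpc : (p : ℕ) ∣ Nat.card (S t) := by
      have := Subgroup.card_mul_index (S t)
      rw [← this] at hpG
      exact ((Nat.Prime.dvd_mul p.2).1 hpG).resolve_right fun hd => hSt.2 p hd hps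
    exact block_subset_compl hσ hs ht hst ((hS t ht).1 p hpc) hps

theorem isPermutable_of_normal (h : IsFull σ G) (A : Subgroup G) [A.Normal] : IsPermutable σ A :=
  ⟨h, fun _ _ _ _ => permute_of_normal⟩

theorem IsPermutable.smul (h : IsPermutable σ A) (g : G) :
    IsPermutable σ (MulAut.conj g • A) := by
  refine ⟨h.1, fun s hs H hH => ?_⟩
  have := (h.2 s hs _ (hH.smul g⁻¹)).smul g
  rwa [map_inv, smul_inv_smul] at this

theorem IsPermutable.comap (h : IsFull σ G) {G' : Type*} [Group G']
    {f : G →* G'} (hf : Function.Surjective f) {A : Subgroup G'} (hA : IsPermutable σ A) :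
    IsPermutable σ (A.comap f) :=
  ⟨h, fun s hs _ hH => permute_comap_of_permute_map f (hA.2 s hs _ (hH.map hf))⟩

theorem IsPermutable.inf [Finite G] (hA : IsPermutable σ A) (hB : IsPermutable σ B)
    (h : Permute A B) : IsPermutable σ (A ⊓ B) :=
  ⟨hA.1, fun s hs H hH => h.inf_hall hH (hA.2 s hs H hH) (hB.2 s hs H hH)⟩

/-- Subgroups containing a Hall `s`-subgroup for every block `s` are improper. -/
theorem eq_top_of_hall_le (hσ : Setoid.IsPartition σ) {Z : Subgroup G}
    (h : ∀ s ∈ σ, ∃ H ≤ Z, IsHall s H) : Z = ⊤ := by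
  refine Subgroup.index_eq_one.1 (eq_one_of_forall_not_dvd fun p hp => ?_)
  obtain ⟨s, hs, hps⟩ := exists_block hσ p
  obtain ⟨H, hHZ, hH⟩ := h s hs
  exact hH.2 p (hp.trans (Subgroup.index_dvd_of_le hHZ)) hps

theorem isPiNumber_index_of_hall_le (hσ : Setoid.IsPartition σ) {Z : Subgroup G}
    {s : Set Nat.Primes} (h : ∀ t ∈ σ, t ≠ s → ∃ H ≤ Z, IsHall t H) : IsPiNumber s Z.index := by
  intro p hp
  obtain ⟨t, ht, hpt⟩ := exists_block hσ p
  by_contra hps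
  obtain ⟨H, hHZ, hH⟩ := h t ht (fun e => hps (e ▸ hpt))
  exact hH.2 p (hp.trans (Subgroup.index_dvd_of_le hHZ)) hpt

/-- A Hall `t`-subgroup lies in `O^s(G)` for `t ≠ s`. -/
theorem IsHall.le_upperO (hσ : Setoid.IsPartition σ) {s t : Set Nat.Primes} (hs : s ∈ σ)
    (ht : t ∈ σ) (hst : s ≠ t) (hH : IsHall t H) : H ≤ upperO s := by
  refine le_sInf ?_
  rintro N ⟨hN, hi⟩
  exact Subgroup.relIndex_eq_one.1 (IsPiNumber.eq_one (π := s)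
    (hi.of_dvd (Subgroup.relIndex_dvd_index_of_normal N H))
    ((IsPiNumber.of_dvd hH.1 (Subgroup.relIndex_dvd_card _ _)).mono
      (block_subset_compl hσ hs ht hst)))

/-- `s`-subgroups contained in all Hall `s`-subgroups and normalized by `O^s(G)` are
`σ`-permutable. -/
theorem isPermutable_of_isPiSubgroup (hσ : Setoid.IsPartition σ) (h : IsFull σ G)
    {s : Set Nat.Primes} (hs : s ∈ σ) (hle : ∀ H : Subgroup G, IsHall s H → A ≤ H)
    (hn : upperO s ≤ Subgroup.normalizer (A : Set G)) : IsPermutable σ A := by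
  refine ⟨h, fun t ht H hH => ?_⟩
  by_cases hst : s = t
  · subst hst
    exact permute_of_le (hle H hH)
  · exact permute_of_le_normalizer ((hH.le_upperO hσ hs ht hst).trans hn)

/-- `σ`-permutable `s`-subgroups lie in every Hall `s`-subgroup. -/
theorem IsPermutable.le_hall (hA : IsPermutable σ A) {s : Set Nat.Primes} (hs : s ∈ σ)
    (hAs : IsPiSubgroup s A) (hH : IsHall s H) : A ≤ H :=
  hH.le_of_permute hAs (hA.2 s hs H hH)

/-- The intersection `O_s(G)` of all Hall `s`-subgroups. -/
def hallCore (s : Set Nat.Primes) (G : Type*) [Group G] : Subgroup G :=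
  sInf {H : Subgroup G | IsHall s H}

instance hallCore_normal (s : Set Nat.Primes) : (hallCore s G).Normal := by
  refine ⟨fun n hn g => ?_⟩
  rw [hallCore, Subgroup.mem_sInf] at hn ⊢
  intro H hH
  have := mem_conj_smul.1 (hn _ (hH.smul g⁻¹))
  simpa using this

theorem isPiSubgroup_hallCore (h : IsFull σ G) {s : Set Nat.Primes} (hs : s ∈ σ) :
    IsPiSubgroup s (hallCore s G) := by
  obtain ⟨H, hH⟩ := h.exists_isHall hs
  exact hH.1.mono (sInf_le hH)

theorem IsPermutable.le_hallCore (hA : IsPermutable σ A) {s : Set Nat.Primes} (hs : s ∈ σ)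
    (hAs : IsPiSubgroup s A) : A ≤ hallCore s G :=
  le_sInf fun _ hH => hA.le_hall hs hAs hH

/-- A `σ`-permutable `s`-subgroup is normalized by the Hall `t`-subgroups with `t ≠ s`. -/
theorem IsPermutable.hall_le_normalizer (hσ : Setoid.IsPartition σ) (hA : IsPermutable σ A)
    {s t : Set Nat.Primes} (hs : s ∈ σ) (ht : t ∈ σ) (hst : s ≠ t)
    (hAs : IsPiSubgroup s A) (hH : IsHall t H) : H ≤ Subgroup.normalizer (A : Set G) := by
  have hbot : H ⊓ hallCore s G = ⊥ := (Subgroup.disjoint_of_coprime_natCard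
    (Nat.Coprime.symm (IsPiNumber.coprime (isPiSubgroup_hallCore hA.1 hs)
      (IsPiNumber.mono hH.1 (block_subset_compl hσ hs ht hst))))).eq_bot
  -- as `H` and `O_s(G)` have coprime orders, the modular law gives `A = AH ∩ O_s(G)`
  have he : A = (A ⊔ H) ⊓ hallCore s G := by
    refine le_antisymm (le_inf le_sup_left (hA.le_hallCore hs hAs)) ?_
    refine ((hA.2 t ht H hH).sup_inf_le (hA.le_hallCore hs hAs)).trans ?_
    rw [hbot, sup_bot_eq]
  rw [he]
  exact le_normalizer_inf (le_sup_right.trans Subgroup.le_normalizer) le_normalizer_of_normal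

/-- `O^s(G)` lies in every subgroup containing all members of a conjugation invariant family with
Hall `t`-subgroups for all blocks `t ≠ s`. -/
theorem upperO_le (hσ : Setoid.IsPartition σ) {s : Set Nat.Primes} {X : Set (Subgroup G)}
    (hconj : ∀ (g : G), ∀ T ∈ X, MulAut.conj g • T ∈ X)
    (hX : ∀ t ∈ σ, t ≠ s → ∃ T ∈ X, IsHall t T) {Z : Subgroup G} (hZ : ∀ T ∈ X, T ≤ Z) :
    upperO s ≤ Z := by
  have hle : ∀ g : G, MulAut.conj g • sSup X ≤ sSup X := fun g => by
    rw [Subgroup.pointwise_smul_subset_iff]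
    refine sSup_le fun T hT => ?_
    rw [Subgroup.subset_pointwise_smul_iff, inv_inv]
    exact le_sSup (hconj g T hT)
  have hn : (sSup X).Normal := by
    refine Subgroup.Normal.of_conjugate_fixed fun g => le_antisymm (hle g) ?_
    rw [Subgroup.subset_pointwise_smul_iff, ← map_inv]
    exact hle g⁻¹
  refine le_trans (sInf_le ⟨hn, isPiNumber_index_of_hall_le hσ fun t ht hts => ?_⟩) (sSup_le hZ)
  obtain ⟨T, hT, hTt⟩ := hX t ht hts
  exact ⟨T, le_sSup hT, hTt⟩

/-- A `σ`-permutable `s`-subgroup is normalized by `O^s(G)`. -/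
theorem IsPermutable.upperO_le_normalizer (hσ : Setoid.IsPartition σ) (hA : IsPermutable σ A)
    {s : Set Nat.Primes} (hs : s ∈ σ) (hAs : IsPiSubgroup s A) :
    upperO s ≤ Subgroup.normalizer (A : Set G) := by
  refine upperO_le hσ (X := {H | ∃ t ∈ σ, t ≠ s ∧ IsHall t H}) ?_ (fun t ht hts => ?_) ?_
  · rintro g H ⟨t, ht, hts, hH⟩
    exact ⟨t, ht, hts, hH.smul g⟩
  · obtain ⟨H, hH⟩ := hA.1.exists_isHall ht
    exact ⟨H, ⟨t, ht, hts, hH⟩, hH⟩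
  · rintro H ⟨t, ht, hts, hH⟩
    exact hA.hall_le_normalizer hσ hs ht hts.symm hAs hH

end Full

/-! ### Distributivity of the lattice of `σ`-permutable subgroups: consequences -/

section Distributive

/-- Relative complements in a distributive lattice are unique. -/
theorem IsDistributive.eq_of_inf_eq_sup_eq {L : Type*} [Lattice L] (h : IsDistributive L)
    {x y a : L} (hi : a ⊓ x = a ⊓ y) (hs : a ⊔ x = a ⊔ y) : x = y := by
  have key : ∀ {x y : L}, a ⊓ x = a ⊓ y → a ⊔ x = a ⊔ y → x ≤ y := by
    intro x y hi hs
    have h1 : x = (x ⊓ a) ⊔ (x ⊓ y) := by rw [← h, ← hs, inf_eq_left.2 le_sup_right]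
    rw [h1]
    exact sup_le (inf_comm x a ▸ hi ▸ inf_le_right) inf_le_right
  exact le_antisymm (key hi hs) (key hi.symm hs.symm)

variable {G : Type*} [Group G] {σ : Set (Set Nat.Primes)}

theorem coe_sup (A B : PermutableSubgroups σ G) : (A ⊔ B).1 = A.1 ⊔ B.1 := rfl

theorem coe_inf_le (A B : PermutableSubgroups σ G) : (A ⊓ B).1 ≤ A.1 ⊓ B.1 :=
  le_inf (inf_le_left : A ⊓ B ≤ A) (inf_le_right : A ⊓ B ≤ B)

/-- If the intersection of `A` and `B` is `σ`-permutable, it is their meet. -/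
theorem coe_inf {A B : PermutableSubgroups σ G} (h : IsPermutable σ (A.1 ⊓ B.1)) :
    (A ⊓ B).1 = A.1 ⊓ B.1 := by
  have h1 : (⟨A.1 ⊓ B.1, h⟩ : PermutableSubgroups σ G) ≤ A ⊓ B :=
    le_inf (inf_le_left : A.1 ⊓ B.1 ≤ A.1) (inf_le_right : A.1 ⊓ B.1 ≤ B.1)
  exact le_antisymm (coe_inf_le A B) h1

/-- The conjugate of a `σ`-permutable subgroup, as an element of the lattice. -/
def conjPermutable (g : G) (A : PermutableSubgroups σ G) : PermutableSubgroups σ G :=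
  ⟨MulAut.conj g • A.1, A.2.smul g⟩

theorem conjPermutable_mono (g : G) {A B : PermutableSubgroups σ G} (h : A ≤ B) :
    conjPermutable g A ≤ conjPermutable g B :=
  Subgroup.pointwise_smul_le_pointwise_smul_iff.2 h

theorem conjPermutable_inv (g : G) (A : PermutableSubgroups σ G) :
    conjPermutable g⁻¹ (conjPermutable g A) = A :=
  Subtype.ext (by simp [conjPermutable])

theorem conjPermutable_inv' (g : G) (A : PermutableSubgroups σ G) :
    conjPermutable g (conjPermutable g⁻¹ A) = A :=
  Subtype.ext (by simp [conjPermutable])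

theorem conjPermutable_of_mem {g : G} {A : PermutableSubgroups σ G} (h : g ∈ A.1) :
    conjPermutable g A = A :=
  Subtype.ext (Subgroup.conj_smul_eq_self_of_mem h)

theorem conjPermutable_inf (g : G) (A B : PermutableSubgroups σ G) :
    conjPermutable g (A ⊓ B) = conjPermutable g A ⊓ conjPermutable g B := by
  refine le_antisymm (le_inf (conjPermutable_mono g inf_le_left)
    (conjPermutable_mono g inf_le_right)) ?_
  rw [← conjPermutable_inv' g (conjPermutable g A ⊓ conjPermutable g B)]
  refine conjPermutable_mono g (le_inf ?_ ?_)
  · conv_rhs => rw [← conjPermutable_inv g A]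
    exact conjPermutable_mono _ inf_le_left
  · conv_rhs => rw [← conjPermutable_inv g B]
    exact conjPermutable_mono _ inf_le_right

theorem conjPermutable_sup (g : G) (A B : PermutableSubgroups σ G) :
    conjPermutable g (A ⊔ B) = conjPermutable g A ⊔ conjPermutable g B :=
  Subtype.ext (Subgroup.smul_sup _ _ _)

/-- In a distributive lattice of `σ`-permutable subgroups any two members `A`, `B` permute. By
induction on `|A|` the `A`-conjugates of `C = A ∧ B` permute with `B`, hence so does the subgroup
`M` they generate; and `A` normalizes `B ∨ M`, because `B ∨ M` and its conjugates under `A` have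
the same meet `M` and the same join with `A`. -/
theorem permute_of_isDistributive [Finite G]
    (h : IsDistributive (PermutableSubgroups σ G)) : ConditionI σ G := by
  suffices H : ∀ (n : ℕ) (A B : PermutableSubgroups σ G), Nat.card A.1 = n → Permute A.1 B.1 from
    fun A B => H _ A B rfl
  intro n
  induction n using Nat.strong_induction_on with
  | _ n ih =>
  intro A B hn
  by_cases hAB : A ≤ B
  · exact permute_of_le hAB
  let C := A ⊓ B
  have hCA : C.1 < A.1 :=
    lt_of_le_of_ne (inf_le_left : C ≤ A) fun e => hAB (inf_eq_left.1 (Subtype.ext e))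
  have hconj : ∀ a : G, Permute (MulAut.conj a • C.1) B.1 := fun a =>
    ih (Nat.card (MulAut.conj a • C.1 : Subgroup G))
      (by rw [card_conj_smul, ← hn]
          exact Set.Finite.card_lt_card (Set.toFinite _) hCA)
      (conjPermutable a C) B rfl
  let T : Set (Subgroup G) := (fun a : G => MulAut.conj a • C.1) '' A.1
  have hTp : ∀ U ∈ T, IsPermutable σ U := by
    rintro _ ⟨a, -, rfl⟩
    exact C.2.smul a
  let M : PermutableSubgroups σ G := ⟨sSup T, isPermutable_sSup A.2.1 T hTp⟩
  have hMB : Permute M.1 B.1 := permute_sSup T B.1 (by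
    rintro _ ⟨a, -, rfl⟩
    exact hconj a)
  have hCM : ∀ a ∈ A.1, conjPermutable a C ≤ M := fun a ha => le_sSup (α := Subgroup G) ⟨a, ha, rfl⟩
  have hMA : M ≤ A := by
    refine sSup_le (α := Subgroup G) ?_
    rintro _ ⟨a, ha, rfl⟩
    exact (conjPermutable_mono a (inf_le_left : C ≤ A)).trans (conjPermutable_of_mem ha).le
  have hMle : ∀ a ∈ A.1, conjPermutable a M ≤ M := by
    intro a ha
    refine Subgroup.pointwise_smul_subset_iff.2 (sSup_le ?_)
    rintro _ ⟨b, hb, rfl⟩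
    rw [Subgroup.subset_pointwise_smul_iff, inv_inv, smul_smul, ← map_mul]
    exact le_sSup ⟨a * b, mul_mem ha hb, rfl⟩
  have hMeq : ∀ a ∈ A.1, conjPermutable a M = M := fun a ha =>
    le_antisymm (hMle a ha) (by
      rw [← conjPermutable_inv' a M]
      refine conjPermutable_mono a ?_
      rw [conjPermutable_inv' a M]
      exact hMle _ (inv_mem ha))
  -- `BM` and its conjugates under `A` are complements of `A` between `M` and `A ⊔ B`
  have hinf : ∀ a ∈ A.1, A ⊓ (conjPermutable a B ⊔ M) = M := by
    intro a ha
    have e : A ⊓ conjPermutable a B = conjPermutable a C := by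
      rw [conjPermutable_inf, conjPermutable_of_mem ha]
    rw [h, e, inf_eq_right.2 hMA]
    exact sup_eq_right.2 (hCM a ha)
  have hsup : ∀ a ∈ A.1, A ⊔ (conjPermutable a B ⊔ M) = A ⊔ B := by
    intro a ha
    have e : A ⊔ conjPermutable a B = A ⊔ B := by
      conv_lhs => rw [← conjPermutable_of_mem ha, ← conjPermutable_sup,
        conjPermutable_of_mem (g := a) (A := A ⊔ B) (Subgroup.mem_sup_left ha)]
    rw [← sup_assoc, e, sup_eq_left]
    exact hMA.trans le_sup_left
  have hone : conjPermutable (1 : G) B = B := Subtype.ext (by simp [conjPermutable])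
  have hnorm : ∀ a ∈ A.1, conjPermutable a (B ⊔ M) = B ⊔ M := by
    intro a ha
    rw [conjPermutable_sup, hMeq a ha]
    refine h.eq_of_inf_eq_sup_eq (a := A) ?_ ?_
    · have h1 := hinf 1 (one_mem _)
      rw [hone] at h1
      rw [hinf a ha, h1]
    · have h1 := hsup 1 (one_mem _)
      rw [hone] at h1
      rw [hsup a ha, h1]
  have hAn : A.1 ≤ Subgroup.normalizer ((B.1 ⊔ M.1 : Subgroup G) : Set G) :=
    le_normalizer_of_forall fun a ha x hx => by
      have e : MulAut.conj a • (B.1 ⊔ M.1) = B.1 ⊔ M.1 := congrArg Subtype.val (hnorm a ha)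
      rw [← e, mem_conj_smul]
      simpa [mul_assoc] using hx
  have hp : Permute A.1 (B.1 ⊔ M.1) := (permute_of_le_normalizer hAn).symm
  -- `A(MB)` is a group, and equals `AB` because `M ≤ A`
  refine permute_of_forall_mem_sup fun x hx => ?_
  obtain ⟨a, ha, y, hy, rfl⟩ := hp.exists_of_mem_sup (sup_le_sup_left le_sup_left A.1 hx)
  obtain ⟨m, hm, b, hb, rfl⟩ := hMB.exists_of_mem_sup (sup_comm B.1 M.1 ▸ hy)
  exact ⟨a * m, mul_mem ha (hMA hm), b, hb, by group⟩

/-- The normal subgroups form a sublattice of the lattice of `σ`-permutable subgroups. -/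
theorem conditionII_of_isDistributive (hG : IsFull σ G)
    (h : IsDistributive (PermutableSubgroups σ G)) : ConditionII G := by
  intro A B C
  have := A.2
  have := B.2
  have := C.2
  have p : ∀ N : Subgroup G, N.Normal → IsPermutable σ N := fun N _ => isPermutable_of_normal hG N
  have e := congrArg Subtype.val (h ⟨A.1, p _ A.2⟩ ⟨B.1, p _ B.2⟩ ⟨C.1, p _ C.2⟩)
  rw [coe_sup, coe_inf (p _ (A ⊓ (B ⊔ C)).2), coe_inf (p _ (A ⊓ B).2),
    coe_inf (p _ (A ⊓ C).2)] at e
  exact Subtype.ext e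

end Distributive

/-! ### Finite groups with distributive subgroup lattice -/

section Ore

variable {Q : Type*} [Group Q]

/-- In a group with distributive subgroup lattice, any two elements commute: with `c = ab` one has
`⟨a⟩ = (⟨a⟩ ∩ ⟨b⟩)(⟨a⟩ ∩ ⟨c⟩)`, and both factors centralize `b`. -/
theorem commute_of_isDistributive (h : IsDistributive (Subgroup Q)) (a b : Q) : a * b = b * a := by
  have hle : Subgroup.zpowers a ≤ Subgroup.zpowers b ⊔ Subgroup.zpowers (a * b) := by
    rw [Subgroup.zpowers_le]
    have h1 := mul_mem (Subgroup.mem_sup_right (S := Subgroup.zpowers b)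
      (Subgroup.mem_zpowers (a * b)))
      (inv_mem (Subgroup.mem_sup_left (T := Subgroup.zpowers (a * b)) (Subgroup.mem_zpowers b)))
    rwa [mul_inv_cancel_right] at h1
  have e : Subgroup.zpowers a ≤ Subgroup.centralizer {b} := by
    rw [← inf_eq_left.2 hle, h]
    refine sup_le ?_ ?_
    · rintro _ ⟨-, ⟨n, rfl⟩⟩
      rw [Subgroup.mem_centralizer_singleton_iff]
      exact ((Commute.refl b).zpow_left n).eq
    · rintro x ⟨⟨n, rfl⟩, ⟨m, hm⟩⟩
      rw [Subgroup.mem_centralizer_singleton_iff]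
      have h1 : Commute (a ^ n) a := (Commute.refl a).zpow_left n
      have h2 : Commute (a ^ n) (a * b) := by
        have h3 : (a * b) ^ m = a ^ n := hm
        rw [← h3]
        exact (Commute.refl _).zpow_left m
      have h4 : Commute (a ^ n) (a⁻¹ * (a * b)) := h1.inv_right.mul_right h2
      rw [inv_mul_cancel_left] at h4
      exact h4.eq
  exact Subgroup.mem_centralizer_singleton_iff.1 (e (Subgroup.mem_zpowers a))

/-- In a group with distributive subgroup lattice, subgroups of the same prime order coincide. -/
theorem mem_zpowers_of_isDistributive (h : IsDistributive (Subgroup Q)) {p : ℕ} (hp : p.Prime)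
    {a b : Q} (ha : orderOf a = p) (hb : orderOf b = p) : b ∈ Subgroup.zpowers a := by
  have hcard : ∀ x : Q, orderOf x = p → Nat.card (Subgroup.zpowers x) = p := fun x hx => by
    rw [Nat.card_zpowers, hx]
  have hpp := Fact.mk hp
  have hfin : ∀ x : Q, orderOf x = p → Finite (Subgroup.zpowers x) := fun x hx =>
    Nat.finite_of_card_ne_zero (by rw [hcard x hx]; exact hp.ne_zero)
  have hfa := hfin a ha
  have hab : ∀ K : Subgroup Q, K ≤ Subgroup.zpowers a → K = ⊥ ∨ K = Subgroup.zpowers a := by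
    intro K hK
    have hd := Subgroup.card_dvd_of_le hK
    rw [hcard a ha, Nat.dvd_prime hp] at hd
    rcases hd with hd | hd
    · exact Or.inl (Subgroup.card_eq_one.1 hd)
    · exact Or.inr (Subgroup.eq_of_le_of_card_ge hK (by rw [hd, hcard a ha]))
  have hle : Subgroup.zpowers a ≤ Subgroup.zpowers b ⊔ Subgroup.zpowers (a * b) := by
    rw [Subgroup.zpowers_le]
    have h1 := mul_mem (Subgroup.mem_sup_right (S := Subgroup.zpowers b)
      (Subgroup.mem_zpowers (a * b)))
      (inv_mem (Subgroup.mem_sup_left (T := Subgroup.zpowers (a * b)) (Subgroup.mem_zpowers b)))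
    rwa [mul_inv_cancel_right] at h1
  have hfb := hfin b hb
  rcases hab _ (inf_le_left : Subgroup.zpowers a ⊓ Subgroup.zpowers b ≤ _) with hi | hi
  · -- then `⟨a⟩` is contained in `⟨ab⟩`, which has order at most `p`
    have e : Subgroup.zpowers a ≤ Subgroup.zpowers (a * b) := by
      conv_lhs => rw [← inf_eq_left.2 hle, h, hi, bot_sup_eq]
      exact inf_le_right
    have hpow : (a * b) ^ p = 1 := by
      have hc : Commute a b := commute_of_isDistributive h a b
      rw [hc.mul_pow, ← ha, pow_orderOf_eq_one, one_mul, ha, ← hb, pow_orderOf_eq_one]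
    have hc : Nat.card (Subgroup.zpowers (a * b)) ∣ p := by
      rw [Nat.card_zpowers]
      exact orderOf_dvd_of_pow_eq_one hpow
    have hfc : Finite (Subgroup.zpowers (a * b)) := Nat.finite_of_card_ne_zero
      (fun h0 => hp.ne_zero (Nat.eq_zero_of_zero_dvd (h0 ▸ hc)))
    have e' := Subgroup.eq_of_le_of_card_ge e (by rw [hcard a ha]; exact Nat.le_of_dvd hp.pos hc)
    have h1 := mul_mem (inv_mem (Subgroup.mem_zpowers a)) (e' ▸ Subgroup.mem_zpowers (a * b))
    rwa [inv_mul_cancel_left] at h1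
  · have e := Subgroup.eq_of_le_of_card_ge (inf_eq_left.1 hi) (by rw [hcard a ha, hcard b hb])
    rw [e]
    exact Subgroup.mem_zpowers b

/-- **Ore's theorem**: a finite group whose subgroup lattice is distributive is cyclic. -/
theorem isCyclic_of_isDistributive [Finite Q] (h : IsDistributive (Subgroup Q)) : IsCyclic Q := by
  let _ : CommGroup Q := { ‹Group Q› with mul_comm := commute_of_isDistributive h }
  obtain ⟨g, hg⟩ := Monoid.exists_orderOf_eq_exponent (G := Q) Monoid.ExponentExists.of_finite
  have hpow : ∀ x : Q, x ^ orderOf g = 1 := fun x => hg ▸ Monoid.pow_exponent_eq_one x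
  refine ⟨g, fun x => ?_⟩
  by_contra hx
  -- some power `y` of `x` satisfies `y ∉ ⟨g⟩` and `y ^ p ∈ ⟨g⟩` for a prime `p`
  obtain ⟨y, p, hp, hy, hyp⟩ : ∃ (y : Q) (p : ℕ), p.Prime ∧ y ∉ Subgroup.zpowers g ∧
      y ^ p ∈ Subgroup.zpowers g := by
    let q : Q ⧸ Subgroup.zpowers g := QuotientGroup.mk x
    have hq : orderOf q ≠ 1 := fun e => hx ((QuotientGroup.eq_one_iff x).1 (orderOf_eq_one_iff.1 e))
    obtain ⟨p, hp, m, hm⟩ := Nat.exists_prime_and_dvd hq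
    have hq0 : 0 < orderOf q := orderOf_pos q
    have hpow : ∀ k : ℕ, x ^ k ∈ Subgroup.zpowers g ↔ orderOf q ∣ k := fun k => by
      rw [← QuotientGroup.eq_one_iff, QuotientGroup.mk_pow, orderOf_dvd_iff_pow_eq_one]
    refine ⟨x ^ m, p, hp, ?_, ?_⟩
    · rw [hpow, hm]
      intro hd
      have hm0 : 0 < m := Nat.pos_of_ne_zero fun e => by simp [hm, e] at hq0
      have := Nat.le_of_dvd hm0 hd
      have := hp.two_le
      nlinarith
    · rw [← pow_mul, hpow, hm, mul_comm]
  have hpn : p ∣ orderOf g := by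
    by_contra hpn
    have hc : Nat.Coprime p (orderOf g) := (Nat.Prime.coprime_iff_not_dvd hp).2 hpn
    have hg' := Nat.gcd_eq_gcd_ab p (orderOf g)
    rw [hc, Nat.cast_one] at hg'
    apply hy
    have e : y = (y ^ p) ^ (Nat.gcdA p (orderOf g)) * (y ^ orderOf g) ^ Nat.gcdB p (orderOf g) := by
      rw [← zpow_natCast, ← zpow_natCast, ← zpow_mul, ← zpow_mul, ← zpow_add, ← hg', zpow_one]
    rw [hpow, one_zpow, mul_one] at e
    rw [e]
    exact zpow_mem hyp _
  obtain ⟨m, hm⟩ := hpn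
  have hn0 : 0 < orderOf g := orderOf_pos g
  obtain ⟨k, hk⟩ := hyp
  have hk : g ^ k = y ^ p := hk
  have hpk : (p : ℤ) ∣ k := by
    have h1 : g ^ (k * m) = 1 := by
      rw [zpow_mul, hk, zpow_natCast, ← pow_mul, ← hm, hpow]
    have h2 := orderOf_dvd_iff_zpow_eq_one.2 h1
    rw [hm, Nat.cast_mul] at h2
    have hm0 : (m : ℤ) ≠ 0 := fun e => by
      rw [Int.natCast_eq_zero] at e
      simp [hm, e] at hn0
    exact Int.dvd_of_mul_dvd_mul_right hm0 h2
  obtain ⟨j, rfl⟩ := hpk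
  have hz : y * (g ^ j)⁻¹ ∉ Subgroup.zpowers g := fun hz => hy (by
    have := mul_mem hz (zpow_mem (Subgroup.mem_zpowers g) j)
    rwa [inv_mul_cancel_right] at this)
  have hzp : orderOf (y * (g ^ j)⁻¹) = p := by
    have := Fact.mk hp
    refine orderOf_eq_prime ?_ fun e => hz (e ▸ one_mem _)
    rw [mul_pow, ← hk, inv_pow, ← zpow_natCast, ← zpow_mul, mul_comm j, mul_inv_cancel]
  have hgm : orderOf (g ^ m) = p := by
    rw [orderOf_pow_of_dvd (fun e => by simp [hm, e] at hn0) ⟨p, by rw [hm, mul_comm]⟩, hm,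
      Nat.mul_div_cancel _ (Nat.pos_of_ne_zero fun e => by simp [hm, e] at hn0)]
  have h1 := mem_zpowers_of_isDistributive h hp hgm hzp
  exact hz ((Subgroup.zpowers_le.2 (pow_mem (Subgroup.mem_zpowers g) m)) h1)

end Ore

/-! ### The `σ`-nilpotent residual -/

section Residual

variable {G : Type*} [Group G] {σ : Set (Set Nat.Primes)}

theorem IsNilpotent.exists_normal_isHall (h : IsNilpotent σ G) {s : Set Nat.Primes} (hs : s ∈ σ) :
    ∃ U : Subgroup G, U.Normal ∧ IsHall s U := by
  obtain ⟨𝓗, h𝓗, hn, -⟩ := h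
  by_cases hp : ∃ p ∈ s, (p : ℕ) ∣ Nat.card G
  · obtain ⟨U, hU, -⟩ := h𝓗.2 s hs hp
    exact ⟨U, hn U hU.1, hU.2⟩
  · exact ⟨⊥, inferInstance, isHall_bot fun p hpG hps => hp ⟨p, hps, hpG⟩⟩

theorem IsNilpotent.commute (hσ : Setoid.IsPartition σ) (h : IsNilpotent σ G)
    {s t : Set Nat.Primes} (hs : s ∈ σ) (ht : t ∈ σ) (hst : s ≠ t) {H T : Subgroup G}
    (hH : IsPiSubgroup s H) (hT : IsPiSubgroup t T) {x y : G} (hx : x ∈ H) (hy : y ∈ T) :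
    x * y = y * x := by
  obtain ⟨U, hUn, hU⟩ := h.exists_normal_isHall hs
  obtain ⟨V, hVn, hV⟩ := h.exists_normal_isHall ht
  have hd : Disjoint U V := Subgroup.disjoint_of_coprime_natCard
    (IsPiNumber.coprime hU.1 (IsPiNumber.mono hV.1 (block_subset_compl hσ hs ht hst)))
  exact Subgroup.commute_of_normal_of_disjoint U V hUn hVn hd x y (hU.le_of_isPiSubgroup hH hx)
    (hV.le_of_isPiSubgroup hT hy)

/-- Elements of Hall subgroups for distinct blocks commute modulo the `σ`-nilpotent residual. -/
theorem commutator_mem_residual (hσ : Setoid.IsPartition σ)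
    {s t : Set Nat.Primes} (hs : s ∈ σ) (ht : t ∈ σ) (hst : s ≠ t) {H T : Subgroup G}
    (hH : IsHall s H) (hT : IsHall t T) {x y : G} (hx : x ∈ H) (hy : y ∈ T) :
    x * y * x⁻¹ * y⁻¹ ∈ residual σ G := by
  rw [residual, Subgroup.mem_sInf]
  rintro N ⟨hN, h⟩
  have hsur := QuotientGroup.mk'_surjective N
  have := h.commute hσ hs ht hst (hH.map hsur).1 (hT.map hsur).1
    (Subgroup.mem_map_of_mem _ hx) (Subgroup.mem_map_of_mem _ hy)
  rw [← QuotientGroup.eq_one_iff]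
  simp only [QuotientGroup.mk_mul, QuotientGroup.mk_inv]
  rw [QuotientGroup.mk'_apply, QuotientGroup.mk'_apply] at this
  rw [this]
  group

/-- `HD` is normal for every Hall `s`-subgroup `H`: the other Hall subgroups centralize `H` modulo
the residual `D`. -/
theorem normal_hall_sup_residual (hσ : Setoid.IsPartition σ) (hG : IsFull σ G)
    {s : Set Nat.Primes} (hs : s ∈ σ) {H : Subgroup G} (hH : IsHall s H) :
    (H ⊔ residual σ G).Normal := by
  rw [← Subgroup.normalizer_eq_top_iff]
  refine eq_top_of_hall_le hσ fun t ht => ?_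
  by_cases hst : s = t
  · subst hst
    exact ⟨H, le_sup_left.trans Subgroup.le_normalizer, hH⟩
  · obtain ⟨T, hT⟩ := hG.exists_isHall ht
    refine ⟨T, le_normalizer_of_forall fun y hy x hx => ?_, hT⟩
    rw [← SetLike.mem_coe, Subgroup.mul_normal] at hx
    obtain ⟨h, hh, d, hd, rfl⟩ := hx
    have h1 := commutator_mem_residual hσ ht hs (Ne.symm hst) hT hH hy hh
    have h2 : y * d * y⁻¹ ∈ residual σ G := (residual_normal σ G).conj_mem d hd y
    have e : y * (h * d) * y⁻¹ = (y * h * y⁻¹ * h⁻¹) * h * (y * d * y⁻¹) := by group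
    change y * (h * d) * y⁻¹ ∈ _
    rw [e]
    exact mul_mem (mul_mem (Subgroup.mem_sup_right h1) (Subgroup.mem_sup_left hh))
      (Subgroup.mem_sup_right h2)

/-- All subgroups containing the `σ`-nilpotent residual are `σ`-permutable. -/
theorem isPermutable_of_residual_le (hσ : Setoid.IsPartition σ) (hG : IsFull σ G)
    {A : Subgroup G} (hA : residual σ G ≤ A) : IsPermutable σ A := by
  refine ⟨hG, fun s hs H hH => permute_of_forall_mem_sup fun x hx => ?_⟩
  have := normal_hall_sup_residual hσ hG hs hH
  have hp : Permute A (H ⊔ residual σ G) := permute_of_normal.symm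
  obtain ⟨a, ha, y, hy, rfl⟩ := hp.exists_of_mem_sup (sup_le_sup_left le_sup_left A hx)
  rw [sup_comm, ← SetLike.mem_coe, Subgroup.normal_mul] at hy
  obtain ⟨d, hd, h, hh, rfl⟩ := hy
  exact ⟨a * d, mul_mem ha (hA hd), h, hh, by group⟩

/-- The subgroup lattice of the quotient by the `σ`-nilpotent residual embeds into the lattice of
`σ`-permutable subgroups. -/
theorem conditionIII_of_isDistributive [Finite G] (hσ : Setoid.IsPartition σ) (hG : IsFull σ G)
    (h : IsDistributive (PermutableSubgroups σ G)) : ConditionIII σ G := by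
  refine ⟨isCyclic_of_isDistributive fun A B C => ?_, isPermutable_of_normal hG _,
    fun B C => h _ B C⟩
  let f := QuotientGroup.mk' (residual σ G)
  have hf : Function.Surjective f := QuotientGroup.mk'_surjective _
  have hp : ∀ A : Subgroup (G ⧸ residual σ G), IsPermutable σ (A.comap f) := fun A =>
    isPermutable_of_residual_le hσ hG (by
      conv_lhs => rw [← QuotientGroup.ker_mk' (residual σ G)]
      exact MonoidHom.ker_le_comap f A)
  have e := congrArg Subtype.val (h ⟨_, hp A⟩ ⟨_, hp B⟩ ⟨_, hp C⟩)
  have hi : ∀ A B : Subgroup (G ⧸ residual σ G), IsPermutable σ (A.comap f ⊓ B.comap f) :=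
    fun A B => by rw [← Subgroup.comap_inf]; exact hp _
  have hs : ∀ A B : Subgroup (G ⧸ residual σ G), A.comap f ⊔ B.comap f = (A ⊔ B).comap f :=
    fun A B => Subgroup.comap_sup_eq f A B hf
  rw [coe_inf (A := ⟨_, hp A⟩) (B := ⟨_, hp B⟩ ⊔ ⟨_, hp C⟩)
      (by rw [coe_sup]; simp only [hs]; exact hi _ _), coe_sup, coe_sup,
    coe_inf (A := ⟨_, hp A⟩) (B := ⟨_, hp B⟩) (hi A B),
    coe_inf (A := ⟨_, hp A⟩) (B := ⟨_, hp C⟩) (hi A C)] at e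
  simp only [hs, ← Subgroup.comap_inf] at e
  exact Subgroup.comap_injective hf e

end Residual

/-! ### Operator isomorphic sections in a distributive lattice -/

section Correspondence

variable {Q : Type*} [Group Q]

/-- The subgroup `Γ` of `Q × Q` is (the preimage in `H × L` of) the graph of an
`Ω`-isomorphism `H / K → L / K`. -/
structure IsIsoGraph (Ω K H L : Subgroup Q) (Γ : Subgroup (Q × Q)) : Prop where
  left_mem : ∀ {x y : Q}, (x, y) ∈ Γ → x ∈ H
  right_mem : ∀ {x y : Q}, (x, y) ∈ Γ → y ∈ L
  exists_right : ∀ {x : Q}, x ∈ H → ∃ y, (x, y) ∈ Γ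
  exists_left : ∀ {y : Q}, y ∈ L → ∃ x, (x, y) ∈ Γ
  ker_left : ∀ {k : Q}, k ∈ K → (k, 1) ∈ Γ
  ker_right : ∀ {k : Q}, k ∈ K → (1, k) ∈ Γ
  mem_iff : ∀ {x y : Q}, (x, y) ∈ Γ → (x ∈ K ↔ y ∈ K)
  conj_mem : ∀ {a : Q}, a ∈ Ω → ∀ {x y : Q}, (x, y) ∈ Γ → (a⁻¹ * x * a, a⁻¹ * y * a) ∈ Γ

namespace IsIsoGraph

variable {Ω K H L : Subgroup Q} {Γ : Subgroup (Q × Q)}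

theorem left_ker (h : IsIsoGraph Ω K H L Γ) {x : Q} (hx : (x, 1) ∈ Γ) : x ∈ K :=
  (h.mem_iff hx).2 (one_mem _)

theorem right_ker (h : IsIsoGraph Ω K H L Γ) {x : Q} (hx : (1, x) ∈ Γ) : x ∈ K :=
  (h.mem_iff hx).1 (one_mem _)

/-- Restriction of the isomorphism to a subsection `I / K` with image `J / K`. -/
theorem restrict (h : IsIsoGraph Ω K H L Γ) {I J : Subgroup Q} (hI : I ≤ H) (hJ : J ≤ L)
    (hIΩ : Ω ≤ Subgroup.normalizer (I : Set Q)) (hJΩ : Ω ≤ Subgroup.normalizer (J : Set Q))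
    (hK : K ≤ I) (hIJ : ∀ x y, (x, y) ∈ Γ → (x ∈ I ↔ y ∈ J)) :
    IsIsoGraph Ω K I J (Γ ⊓ I.prod J) where
  left_mem hm := hm.2.1
  right_mem hm := hm.2.2
  exists_right hx := by
    obtain ⟨y, hy⟩ := h.exists_right (hI hx)
    exact ⟨y, hy, hx, (hIJ _ _ hy).1 hx⟩
  exists_left hy := by
    obtain ⟨x, hx⟩ := h.exists_left (hJ hy)
    exact ⟨x, hx, (hIJ _ _ hx).2 hy, hy⟩
  ker_left hk := ⟨h.ker_left hk, hK hk, one_mem J⟩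
  ker_right hk := ⟨h.ker_right hk, one_mem I, (hIJ _ _ (h.ker_right hk)).1 (one_mem I)⟩
  mem_iff hm := h.mem_iff hm.1
  conj_mem ha _ _ hm := ⟨h.conj_mem ha hm.1,
    by simpa using conj_mem_of_mem_normalizer (inv_mem (hIΩ ha)) hm.2.1,
    by simpa using conj_mem_of_mem_normalizer (inv_mem (hJΩ ha)) hm.2.2⟩

theorem of_operatorIsomorphic (h : OperatorIsomorphic Ω H L K) : ∃ Γ, IsIsoGraph Ω K H L Γ := by
  obtain ⟨hH, hL, h⟩ := h
  have := hH.normal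
  have := hL.normal
  obtain ⟨f, hf⟩ := h
  let Γ : Subgroup (Q × Q) :=
    { carrier := {z | ∃ (hx : z.1 ∈ H) (hy : z.2 ∈ L),
        f (QuotientGroup.mk ⟨z.1, hx⟩) = QuotientGroup.mk ⟨z.2, hy⟩}
      one_mem' := ⟨one_mem H, one_mem L, f.map_one⟩
      mul_mem' := by
        rintro ⟨x, y⟩ ⟨x', y'⟩ ⟨hx, hy, e⟩ ⟨hx', hy', e'⟩
        refine ⟨mul_mem hx hx', mul_mem hy hy', ?_⟩
        have := f.map_mul (QuotientGroup.mk ⟨x, hx⟩) (QuotientGroup.mk ⟨x', hx'⟩)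
        rw [e, e'] at this
        exact this
      inv_mem' := by
        rintro ⟨x, y⟩ ⟨hx, hy, e⟩
        refine ⟨inv_mem hx, inv_mem hy, ?_⟩
        have := f.map_inv (QuotientGroup.mk ⟨x, hx⟩)
        rw [e] at this
        exact this }
  have h1 : ∀ {k : Q} (hk : k ∈ H), k ∈ K →
      (QuotientGroup.mk ⟨k, hk⟩ : H ⧸ K.subgroupOf H) = 1 := fun hk hkK =>
    (QuotientGroup.eq_one_iff _).2 hkK
  have h2 : ∀ {k : Q} (hk : k ∈ L), k ∈ K →
      (QuotientGroup.mk ⟨k, hk⟩ : L ⧸ K.subgroupOf L) = 1 := fun hk hkK =>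
    (QuotientGroup.eq_one_iff _).2 hkK
  refine ⟨Γ, fun hm => hm.1, fun hm => hm.2.1, fun {x} hx => ?_, fun {y} hy => ?_,
    fun {k} hk => ⟨hH.le hk, one_mem L, ?_⟩, fun {k} hk => ⟨one_mem H, hL.le hk, ?_⟩, ?_, ?_⟩
  · obtain ⟨⟨y, hy⟩, e⟩ := QuotientGroup.mk_surjective (f (QuotientGroup.mk ⟨x, hx⟩))
    exact ⟨y, hx, hy, e.symm⟩
  · obtain ⟨z, hz⟩ := f.surjective (QuotientGroup.mk ⟨y, hy⟩)
    obtain ⟨⟨x, hx⟩, rfl⟩ := QuotientGroup.mk_surjective z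
    exact ⟨x, hx, hy, hz⟩
  · rw [h1 (hH.le hk) hk, f.map_one]
    rfl
  · rw [h2 (hL.le hk) hk]
    exact f.map_one
  · rintro x y ⟨hx, hy, e⟩
    have e1 : x ∈ K ↔ (QuotientGroup.mk ⟨x, hx⟩ : H ⧸ K.subgroupOf H) = 1 := by
      rw [QuotientGroup.eq_one_iff]; rfl
    have e2 : y ∈ K ↔ (QuotientGroup.mk ⟨y, hy⟩ : L ⧸ K.subgroupOf L) = 1 := by
      rw [QuotientGroup.eq_one_iff]; rfl
    rw [e1, e2, ← e]
    exact (map_eq_one_iff f f.injective).symm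
  · rintro a ha x y ⟨hx, hy, e⟩
    exact ⟨_, _, hf a ha ⟨x, hx⟩ ⟨y, hy⟩ e⟩

end IsIsoGraph

/-- In a distributive lattice `𝓖` of subgroups that is closed under conjugation and contains all
`Ω`-invariant subgroups of its members, `Ω`-isomorphic sections `H / K` and `L / K` coincide.
By induction `I = H ∩ L` corresponds to itself under the isomorphism, and is normal in `H` and
`L`; then `H` and `L` normalize each other, and the diagonal of `H / I × L / I` is a complement to
`H / I` besides `L / I`. -/
theorem eq_of_isIsoGraph [Finite Q] {Ω K : Subgroup Q} {𝓖 : Set (Subgroup Q)}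
    (hinf : ∀ U ∈ 𝓖, ∀ V ∈ 𝓖, U ⊓ V ∈ 𝓖) (hsup : ∀ U ∈ 𝓖, ∀ V ∈ 𝓖, U ⊔ V ∈ 𝓖)
    (hconj : ∀ (g : Q), ∀ U ∈ 𝓖, MulAut.conj g • U ∈ 𝓖)
    (hdown : ∀ U ∈ 𝓖, ∀ V ≤ U, Ω ≤ Subgroup.normalizer (V : Set Q) → V ∈ 𝓖)
    (hnorm : ∀ U ∈ 𝓖, Ω ≤ Subgroup.normalizer (U : Set Q))
    (hdist : ∀ U ∈ 𝓖, ∀ V ∈ 𝓖, ∀ W ∈ 𝓖, U ⊓ (V ⊔ W) ≤ (U ⊓ V) ⊔ (U ⊓ W)) :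
    ∀ (n : ℕ) (H L : Subgroup Q) (Γ : Subgroup (Q × Q)), H ∈ 𝓖 → L ∈ 𝓖 →
      Nat.card H + Nat.card L = n → IsIsoGraph Ω K H L Γ → H = L := by
  have huniq : ∀ U ∈ 𝓖, ∀ V ∈ 𝓖, ∀ W ∈ 𝓖, U ⊓ V = U ⊓ W → U ⊔ V = U ⊔ W → V = W := by
    have key : ∀ U ∈ 𝓖, ∀ V ∈ 𝓖, ∀ W ∈ 𝓖, U ⊓ V = U ⊓ W → U ⊔ V = U ⊔ W → V ≤ W := by
      intro U hU V hV W hW hi hs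
      calc V ≤ V ⊓ (U ⊔ W) := le_inf le_rfl (hs ▸ le_sup_right)
        _ ≤ (V ⊓ U) ⊔ (V ⊓ W) := hdist V hV U hU W hW
        _ ≤ W := sup_le (inf_comm U V ▸ hi ▸ inf_le_right) inf_le_right
    exact fun U hU V hV W hW hi hs =>
      le_antisymm (key U hU V hV W hW hi hs) (key U hU W hW V hV hi.symm hs.symm)
  intro n
  induction n using Nat.strong_induction_on with
  | _ n ih =>
  intro H L Γ hH hL hn h
  have hKH : K ≤ H := fun k hk => h.left_mem (h.ker_left hk)
  have hKL : K ≤ L := fun k hk => h.right_mem (h.ker_right hk)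
  by_cases hHL : H ≤ L
  · by_contra hne
    have hlt : Nat.card H < Nat.card L :=
      Set.Finite.card_lt_card (Set.toFinite _) (lt_of_le_of_ne hHL hne : H < L)
    -- `J / K` corresponds to the proper subsection `H / K` of `L / K`
    let J : Subgroup Q := (Γ ⊓ H.comap (MonoidHom.snd Q Q)).map (MonoidHom.fst Q Q)
    have hJ : ∀ x, x ∈ J ↔ ∃ y ∈ H, (x, y) ∈ Γ := by
      intro x
      constructor
      · rintro ⟨⟨x', y⟩, hxy, rfl⟩
        exact ⟨y, hxy.2, hxy.1⟩
      · rintro ⟨y, hy, hxy⟩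
        exact ⟨(x, y), ⟨hxy, hy⟩, rfl⟩
    have hJH : J ≤ H := fun x hx => by
      obtain ⟨y, -, hxy⟩ := (hJ x).1 hx
      exact h.left_mem hxy
    have hJΩ : Ω ≤ Subgroup.normalizer (J : Set Q) := le_normalizer_of_forall fun a ha x hx => by
      obtain ⟨y, hy, hxy⟩ := (hJ x).1 hx
      refine (hJ _).2 ⟨a * y * a⁻¹, conj_mem_of_mem_normalizer (hnorm H hH ha) hy, ?_⟩
      simpa using h.conj_mem (inv_mem ha) hxy
    have e : J = H := by
      refine ih (Nat.card J + Nat.card H) ?_ J H _ (hdown H hH J hJH hJΩ) hH rfl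
        (h.restrict hJH hHL hJΩ (hnorm H hH) (fun k hk => (hJ k).2 ⟨1, one_mem _, h.ker_left hk⟩)
          fun x y hxy => ⟨fun hx => ?_, fun hy => (hJ x).2 ⟨y, hy, hxy⟩⟩)
      · have := Nat.le_of_dvd Nat.card_pos (Subgroup.card_dvd_of_le hJH)
        omega
      · obtain ⟨y', hy', hxy'⟩ := (hJ x).1 hx
        have h1 := h.right_ker (x := y'⁻¹ * y) (by simpa using mul_mem (inv_mem hxy') hxy)
        have h2 := mul_mem hy' (hKH h1)
        rwa [mul_inv_cancel_left] at h2
    refine hne (le_antisymm hHL fun y hy => ?_)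
    obtain ⟨x, hxy⟩ := h.exists_left hy
    have hx : x ∈ J := e.symm ▸ h.left_mem hxy
    obtain ⟨y', hy', hxy'⟩ := (hJ x).1 hx
    have h1 := h.right_ker (x := y'⁻¹ * y) (by simpa using mul_mem (inv_mem hxy') hxy)
    have h2 := mul_mem hy' (hKH h1)
    rwa [mul_inv_cancel_left] at h2
  exfalso
  let I := H ⊓ L
  have hI : I ∈ 𝓖 := hinf H hH L hL
  have hIH : I ≤ H := inf_le_left
  have hIL : I ≤ L := inf_le_right
  have hKI : K ≤ I := le_inf hKH hKL
  have hIlt : Nat.card I < Nat.card H := Set.Finite.card_lt_card (Set.toFinite _)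
    (lt_of_le_of_ne hIH fun e => hHL (inf_eq_left.1 e) : I < H)
  have hcIL : Nat.card I ≤ Nat.card L :=
    Nat.le_of_dvd Nat.card_pos (Subgroup.card_dvd_of_le hIL)
  -- the isomorphism maps `I / K` onto itself
  have hII : ∀ x y, (x, y) ∈ Γ → (x ∈ I ↔ y ∈ I) := by
    let J : Subgroup Q := (Γ ⊓ I.comap (MonoidHom.fst Q Q)).map (MonoidHom.snd Q Q)
    have hJ : ∀ y, y ∈ J ↔ ∃ x ∈ I, (x, y) ∈ Γ := by
      intro y
      constructor
      · rintro ⟨⟨x, y'⟩, hxy, rfl⟩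
        exact ⟨x, hxy.2, hxy.1⟩
      · rintro ⟨x, hx, hxy⟩
        exact ⟨(x, y), ⟨hxy, hx⟩, rfl⟩
    have hJL : J ≤ L := fun y hy => by
      obtain ⟨x, -, hxy⟩ := (hJ y).1 hy
      exact h.right_mem hxy
    have hJΩ : Ω ≤ Subgroup.normalizer (J : Set Q) := le_normalizer_of_forall fun a ha y hy => by
      obtain ⟨x, hx, hxy⟩ := (hJ y).1 hy
      refine (hJ _).2 ⟨a * x * a⁻¹, conj_mem_of_mem_normalizer (hnorm I hI ha) hx, ?_⟩
      simpa using h.conj_mem (inv_mem ha) hxy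
    have hIJ : ∀ x y, (x, y) ∈ Γ → (x ∈ I ↔ y ∈ J) := by
      refine fun x y hxy => ⟨fun hx => (hJ y).2 ⟨x, hx, hxy⟩, fun hy => ?_⟩
      obtain ⟨x', hx', hxy'⟩ := (hJ y).1 hy
      have h1 := h.left_ker (x := x'⁻¹ * x) (by simpa using mul_mem (inv_mem hxy') hxy)
      have h2 := mul_mem hx' (hKI h1)
      rwa [mul_inv_cancel_left] at h2
    have e : I = J := by
      refine ih (Nat.card I + Nat.card J) ?_ I J _ hI (hdown L hL J hJL hJΩ) rfl
        (h.restrict hIH hJL (hnorm I hI) hJΩ hKI hIJ)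
      have := Nat.le_of_dvd Nat.card_pos (Subgroup.card_dvd_of_le hJL)
      omega
    intro x y hxy
    rw [hIJ x y hxy, ← e]
  -- `I` is normalized by `H` and by `L`
  have hIconj : ∀ x y, (x, y) ∈ Γ → MulAut.conj x • I = I ∧ MulAut.conj y • I = I := by
    intro x y hxy
    have hx := h.left_mem hxy
    have hy := h.right_mem hxy
    have hxH : MulAut.conj x • I ≤ H := Subgroup.conj_smul_le_of_le hIH ⟨x, hx⟩
    have hyL : MulAut.conj y • I ≤ L := Subgroup.conj_smul_le_of_le hIL ⟨y, hy⟩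
    have hcx := hconj x I hI
    have hcy := hconj y I hI
    have e : MulAut.conj x • I = MulAut.conj y • I := by
      refine ih (Nat.card I + Nat.card I) (by omega) _ _ _ hcx hcy
        (by rw [card_conj_smul, card_conj_smul])
        (h.restrict hxH hyL (hnorm _ hcx) (hnorm _ hcy) (fun k hk => ?_) fun u v huv => ?_)
      · rw [mem_conj_smul]
        refine hKI (h.left_ker ?_)
        simpa using mul_mem (mul_mem (inv_mem hxy) (h.ker_left hk)) hxy
      · rw [mem_conj_smul, mem_conj_smul]
        exact hII _ _ (by simpa using mul_mem (mul_mem (inv_mem hxy) huv) hxy)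
    have e' : MulAut.conj x • I = I := Subgroup.eq_of_le_of_card_ge
      (le_inf hxH (e.trans_le hyL)) (by rw [card_conj_smul])
    exact ⟨e', e ▸ e'⟩
  have hIx : ∀ x ∈ H, MulAut.conj x • I = I := fun x hx =>
    let ⟨y, hxy⟩ := h.exists_right hx
    (hIconj x y hxy).1
  have hIy : ∀ y ∈ L, MulAut.conj y • I = I := fun y hy =>
    let ⟨x, hxy⟩ := h.exists_left hy
    (hIconj x y hxy).2
  -- `H` and `L` normalize each other
  have hLx : ∀ x ∈ H, MulAut.conj x • L = L := fun x hx => by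
    have hxH : MulAut.conj x • H = H := Subgroup.conj_smul_eq_self_of_mem hx
    refine huniq H hH _ (hconj x L hL) L hL ?_ ?_
    · conv_lhs => rw [← hxH, ← Subgroup.smul_inf]
      exact hIx x hx
    · conv_lhs => rw [← hxH, ← Subgroup.smul_sup]
      exact Subgroup.conj_smul_eq_self_of_mem (Subgroup.mem_sup_left hx)
  have hHy : ∀ y ∈ L, MulAut.conj y • H = H := fun y hy => by
    have hyL : MulAut.conj y • L = L := Subgroup.conj_smul_eq_self_of_mem hy
    refine huniq L hL _ (hconj y H hH) H hH ?_ ?_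
    · conv_lhs => rw [← hyL, ← Subgroup.smul_inf]
      rw [inf_comm L H]
      exact hIy y hy
    · conv_lhs => rw [← hyL, ← Subgroup.smul_sup]
      exact Subgroup.conj_smul_eq_self_of_mem (Subgroup.mem_sup_left hy)
  have conj_mem : ∀ {U : Subgroup Q} {g u : Q}, MulAut.conj g⁻¹ • U = U → u ∈ U →
      g * u * g⁻¹ ∈ U ∧ g⁻¹ * u * g ∈ U := by
    intro U g u e hu
    constructor
    · rw [← e, mem_conj_smul] at hu
      simpa using hu
    · rw [← e, mem_conj_smul]
      simpa [mul_assoc] using hu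
  have hcomm : ∀ x ∈ H, ∀ y ∈ L, y⁻¹ * x⁻¹ * y * x ∈ I := fun x hx y hy => by
    refine ⟨mul_mem ?_ hx, ?_⟩
    · exact (conj_mem (hHy _ (inv_mem hy)) (inv_mem hx)).2
    · have := mul_mem (inv_mem hy) (conj_mem (hLx _ (inv_mem hx)) hy).2
      simpa [mul_assoc] using this
  have hIH' : ∀ x ∈ H, ∀ i ∈ I, x⁻¹ * i * x ∈ I := fun x hx i hi =>
    (conj_mem (hIx _ (inv_mem hx)) hi).2
  have hIL' : ∀ y ∈ L, ∀ i ∈ I, y⁻¹ * i * y ∈ I := fun y hy i hi =>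
    (conj_mem (hIy _ (inv_mem hy)) hi).2
  -- the diagonal subgroup, consisting of the products `x y i` of corresponding elements `x` of `H`
  -- and `y` of `L` with elements `i` of `I`
  let Δ : Subgroup Q :=
    { carrier := {z | ∃ x y i, (x, y) ∈ Γ ∧ i ∈ I ∧ z = x * y * i}
      one_mem' := ⟨1, 1, 1, one_mem Γ, one_mem I, by simp⟩
      mul_mem' := by
        rintro _ _ ⟨x, y, i, hxy, hi, rfl⟩ ⟨x', y', i', hxy', hi', rfl⟩
        have hx' := h.left_mem hxy'
        have hy := h.right_mem hxy
        have hy' := h.right_mem hxy'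
        refine ⟨x * x', y * y',
          y'⁻¹ * ((y⁻¹ * x'⁻¹ * y * x') * (x'⁻¹ * i * x')) * y' * i', mul_mem hxy hxy',
          I.mul_mem (hIL' y' hy' _ (I.mul_mem (hcomm x' hx' y hy) (hIH' x' hx' i hi))) hi', ?_⟩
        group
      inv_mem' := by
        rintro _ ⟨x, y, i, hxy, hi, rfl⟩
        have hx := h.left_mem hxy
        have hy := h.right_mem hxy
        refine ⟨x⁻¹, y⁻¹, (y * (x * i⁻¹ * x⁻¹) * y⁻¹) * (y * x * y⁻¹ * x⁻¹), inv_mem hxy,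
          I.mul_mem ?_ ?_, by group⟩
        · have h1 := hIH' x⁻¹ (inv_mem hx) i⁻¹ (I.inv_mem hi)
          have h2 := hIL' y⁻¹ (inv_mem hy) _ h1
          simpa using h2
        · simpa using hcomm x⁻¹ (inv_mem hx) y⁻¹ (inv_mem hy) }
  have hΔ : Δ ∈ 𝓖 := by
    refine hdown _ (hsup H hH L hL) Δ ?_ (le_normalizer_of_forall fun a ha z hz => ?_)
    · rintro _ ⟨x, y, i, hxy, hi, rfl⟩
      exact mul_mem (mul_mem (Subgroup.mem_sup_left (h.left_mem hxy))
        (Subgroup.mem_sup_right (h.right_mem hxy))) (Subgroup.mem_sup_left hi.1)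
    · obtain ⟨x, y, i, hxy, hi, rfl⟩ := hz
      refine ⟨a * x * a⁻¹, a * y * a⁻¹, a * i * a⁻¹, by simpa using h.conj_mem (inv_mem ha) hxy,
        conj_mem_of_mem_normalizer (hnorm I hI ha) hi, by group⟩
  have hinf' : H ⊓ L = H ⊓ Δ := by
    refine le_antisymm (fun i hi => ⟨hi.1, 1, 1, i, one_mem Γ, hi, by simp⟩) ?_
    rintro _ ⟨hz, x, y, i, hxy, hi, rfl⟩
    have hx := h.left_mem hxy
    have hyH : y ∈ H := by
      have := mul_mem (mul_mem (inv_mem hx) hz) (inv_mem hi.1)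
      simpa [mul_assoc] using this
    have hyI : y ∈ I := ⟨hyH, h.right_mem hxy⟩
    exact I.mul_mem (I.mul_mem ((hII _ _ hxy).2 hyI) hyI) hi
  have hsup' : H ⊔ L = H ⊔ Δ := by
    refine le_antisymm (sup_le le_sup_left fun y hy => ?_) (sup_le le_sup_left ?_)
    · obtain ⟨x, hxy⟩ := h.exists_left hy
      have h1 : x * y ∈ Δ := ⟨x, y, 1, hxy, one_mem I, by simp⟩
      have h2 := mul_mem (Subgroup.mem_sup_left (T := Δ) (inv_mem (h.left_mem hxy)))
        (Subgroup.mem_sup_right (S := H) h1)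
      rwa [inv_mul_cancel_left] at h2
    · rintro _ ⟨x, y, i, hxy, hi, rfl⟩
      exact mul_mem (mul_mem (Subgroup.mem_sup_left (h.left_mem hxy))
        (Subgroup.mem_sup_right (h.right_mem hxy))) (Subgroup.mem_sup_left hi.1)
  have e : L = Δ := huniq H hH L hL Δ hΔ hinf' hsup'
  refine hHL fun x hx => ?_
  obtain ⟨y, hxy⟩ := h.exists_right hx
  have h1 : x * y ∈ L := e ▸ ⟨x, y, 1, hxy, one_mem I, by simp⟩
  have h2 := mul_mem h1 (inv_mem (h.right_mem hxy))
  rwa [mul_inv_cancel_right] at h2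

end Correspondence

section ConditionIV

variable {G : Type*} [Group G] {σ : Set (Set Nat.Primes)}

/-- Subgroups of a `σ`-permutable `s`-subgroup that are normalized by `O^s(G)` are
`σ`-permutable. -/
theorem IsPermutable.of_le (hσ : Setoid.IsPartition σ) {s : Set Nat.Primes} (hs : s ∈ σ)
    {U V : Subgroup G} (hU : IsPermutable σ U) (hUs : IsPiSubgroup s U) (hVU : V ≤ U)
    (hV : upperO s ≤ Subgroup.normalizer (V : Set G)) : IsPermutable σ V :=
  isPermutable_of_isPiSubgroup hσ hU.1 hs (fun _ hH => hVU.trans (hU.le_hall hs hUs hH)) hV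

/-- The `σ`-permutable `s`-subgroups of a quotient of `G` form a lattice to which `eq_of_isIsoGraph`
applies. Distributivity is pulled back from their preimages, which are `σ`-permutable in `G`. -/
theorem conditionIV_of_isDistributive [Finite G] (hσ : Setoid.IsPartition σ) (hG : IsFull σ G)
    (h : IsDistributive (PermutableSubgroups σ G)) : ConditionIV σ G := by
  intro R hR s hs K H L _ hHs hLs hiso
  obtain ⟨Γ, hΓ⟩ := IsIsoGraph.of_operatorIsomorphic hiso
  let f := QuotientGroup.mk' R
  have hf : Function.Surjective f := QuotientGroup.mk'_surjective _
  have hinf : ∀ U : Subgroup (G ⧸ R), IsPermutable σ U ∧ IsPiSubgroup s U →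
      ∀ V : Subgroup (G ⧸ R), IsPermutable σ V ∧ IsPiSubgroup s V →
        IsPermutable σ (U ⊓ V) ∧ IsPiSubgroup s (U ⊓ V) := fun U hU V hV =>
    ⟨hU.1.of_le hσ hs hU.2 inf_le_left (le_normalizer_inf (hU.1.upperO_le_normalizer hσ hs hU.2)
      (hV.1.upperO_le_normalizer hσ hs hV.2)), hU.2.mono inf_le_left⟩
  have hsup : ∀ U : Subgroup (G ⧸ R), IsPermutable σ U ∧ IsPiSubgroup s U →
      ∀ V : Subgroup (G ⧸ R), IsPermutable σ V ∧ IsPiSubgroup s V →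
        IsPermutable σ (U ⊔ V) ∧ IsPiSubgroup s (U ⊔ V) := fun U hU V hV =>
    ⟨isPermutable_sup hU.1 hV.1, (isPiSubgroup_hallCore hU.1.1 hs).mono
      (sup_le (hU.1.le_hallCore hs hU.2) (hV.1.le_hallCore hs hV.2))⟩
  refine Subtype.ext (eq_of_isIsoGraph (𝓖 := {U | IsPermutable σ U ∧ IsPiSubgroup s U})
    hinf hsup (fun g U hU => ⟨hU.1.smul g, hU.2.smul g⟩)
    (fun U hU V hVU hV => ⟨hU.1.of_le hσ hs hU.2 hVU hV, hU.2.mono hVU⟩)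
    (fun U hU => hU.1.upperO_le_normalizer hσ hs hU.2) (fun U hU V hV W hW => ?_)
    _ H.1 L.1 Γ ⟨H.2, hHs⟩ ⟨L.2, hLs⟩ rfl hΓ)
  have hp : ∀ U : Subgroup (G ⧸ R), IsPermutable σ U → IsPermutable σ (U.comap f) :=
    fun U hU => hU.comap hG hf
  have hs' : ∀ A B : Subgroup (G ⧸ R), A.comap f ⊔ B.comap f = (A ⊔ B).comap f :=
    fun A B => Subgroup.comap_sup_eq f A B hf
  have e := congrArg Subtype.val (h ⟨_, hp U hU.1⟩ ⟨_, hp V hV.1⟩ ⟨_, hp W hW.1⟩)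
  rw [coe_inf (A := ⟨_, hp U hU.1⟩) (B := ⟨_, hp V hV.1⟩ ⊔ ⟨_, hp W hW.1⟩)
      (by
        rw [coe_sup, hs', ← Subgroup.comap_inf]
        exact hp _ (hinf U hU _ (hsup V hV W hW)).1), coe_sup, coe_sup,
    coe_inf (A := ⟨_, hp U hU.1⟩) (B := ⟨_, hp V hV.1⟩)
      (by rw [← Subgroup.comap_inf]; exact hp _ (hinf U hU V hV).1),
    coe_inf (A := ⟨_, hp U hU.1⟩) (B := ⟨_, hp W hW.1⟩)
      (by rw [← Subgroup.comap_inf]; exact hp _ (hinf U hU W hW).1)] at e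
  simp only [hs', ← Subgroup.comap_inf] at e
  exact (Subgroup.comap_injective hf e).le

end ConditionIV

/-! ### Diamonds in modular lattices -/

section Lattice

variable {L : Type*} [Lattice L] [IsModularLattice L]

/-- The meet of two of the three elements that generate a diamond in the free modular lattice on
`a`, `b`, `c`. -/
theorem diamond_inf (a b c : L) : ((b ⊓ c) ⊔ a ⊓ (b ⊔ c)) ⊓ ((a ⊓ c) ⊔ b ⊓ (a ⊔ c)) =
    (a ⊓ b) ⊔ (a ⊓ c) ⊔ (b ⊓ c) := by
  rw [← sup_inf_assoc_of_le a (inf_le_left.trans le_sup_left : b ⊓ c ≤ b ⊔ c),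
    ← sup_inf_assoc_of_le b (inf_le_left.trans le_sup_left : a ⊓ c ≤ a ⊔ c)]
  have h1 : (b ⊓ c) ⊔ a ≤ a ⊔ c := sup_le (inf_le_right.trans le_sup_right) le_sup_left
  have h2 : (a ⊓ c) ⊔ b ≤ b ⊔ c := sup_le (inf_le_right.trans le_sup_right) le_sup_left
  have h3 : ((b ⊓ c) ⊔ a) ⊓ (b ⊔ c) ⊓ (((a ⊓ c) ⊔ b) ⊓ (a ⊔ c)) =
      ((b ⊓ c) ⊔ a) ⊓ ((a ⊓ c) ⊔ b) :=
    le_antisymm (inf_le_inf inf_le_left inf_le_left)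
      (le_inf (le_inf inf_le_left (inf_le_right.trans h2))
        (le_inf inf_le_right (inf_le_left.trans h1)))
  rw [h3, sup_inf_assoc_of_le a (inf_le_left.trans le_sup_right : b ⊓ c ≤ (a ⊓ c) ⊔ b),
    inf_comm a, sup_inf_assoc_of_le b (inf_le_left : a ⊓ c ≤ a), inf_comm b a, sup_comm,
    sup_comm (a ⊓ c)]

/-- The join of the two elements of `diamond_inf`. -/
theorem diamond_sup (a b c : L) : ((b ⊓ c) ⊔ a ⊓ (b ⊔ c)) ⊔ ((a ⊓ c) ⊔ b ⊓ (a ⊔ c)) =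
    (a ⊔ b) ⊓ (a ⊔ c) ⊓ (b ⊔ c) := by
  have h1 : (b ⊓ c) ⊔ a ⊓ (b ⊔ c) ⊔ ((a ⊓ c) ⊔ b ⊓ (a ⊔ c)) =
      (a ⊓ (b ⊔ c)) ⊔ b ⊓ (a ⊔ c) := by
    refine le_antisymm (sup_le (sup_le ?_ le_sup_left) (sup_le ?_ le_sup_right))
      (sup_le_sup le_sup_right le_sup_right)
    · exact (inf_le_inf_left b le_sup_right).trans le_sup_right
    · exact (inf_le_inf_left a le_sup_right).trans le_sup_left
  rw [h1, ← sup_inf_assoc_of_le b (inf_le_left.trans le_sup_left : a ⊓ (b ⊔ c) ≤ a ⊔ c),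
    sup_comm (a ⊓ (b ⊔ c)), ← sup_inf_assoc_of_le a (le_sup_left : b ≤ b ⊔ c), sup_comm b a,
    inf_assoc, inf_assoc, inf_comm (b ⊔ c)]

/-- A diamond `u < x, y, z < v` in a finite modular lattice contains a diamond whose atoms
cover its bottom `u`. -/
theorem exists_covBy_diamond [Finite L] {u v x y z : L} (huv : u ≠ v)
    (hxy : x ⊓ y = u) (hxz : x ⊓ z = u) (hyz : y ⊓ z = u)
    (hxy' : x ⊔ y = v) (hxz' : x ⊔ z = v) (hyz' : y ⊔ z = v) :
    ∃ x y z : L, u ⋖ x ∧ u ⋖ y ∧ u ⋖ z ∧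
      x ⊓ y = u ∧ x ⊓ z = u ∧ y ⊓ z = u ∧ x ⊔ z = x ⊔ y ∧ y ⊔ z = x ⊔ y := by
  have hux : u < x := by
    refine lt_of_le_of_ne (hxy ▸ inf_le_left) fun e => huv ?_
    have hy : y = v := by rw [← hxy', ← e, sup_eq_right.2 (hxy ▸ inf_le_right)]
    have hz : z = v := by rw [← hxz', ← e, sup_eq_right.2 (hxz ▸ inf_le_right)]
    rw [← hyz, hy, hz, inf_idem]
  obtain ⟨h, huh, hhx⟩ := exists_covBy_le_of_lt hux
  have hhy : h ⊓ y = u := le_antisymm (hxy ▸ inf_le_inf_right y hhx)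
    (le_inf huh.le (hxy ▸ inf_le_right))
  have hhz : h ⊓ z = u := le_antisymm (hxz ▸ inf_le_inf_right z hhx)
    (le_inf huh.le (hxz ▸ inf_le_right))
  have huy : u ≤ y := hxy ▸ inf_le_right
  have huz : u ≤ z := hxz ▸ inf_le_right
  -- project `h` to `[u, y]` through `z` and to `[u, z]` through `y`
  have s1 : h ⊔ y ⊓ (h ⊔ z) = (h ⊔ y) ⊓ (h ⊔ z) := (sup_inf_assoc_of_le y le_sup_left).symm
  have s2 : h ⊔ z ⊓ (h ⊔ y) = (h ⊔ y) ⊓ (h ⊔ z) := by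
    rw [← sup_inf_assoc_of_le z le_sup_left, inf_comm]
  have s3 : (y ⊓ (h ⊔ z)) ⊔ z = h ⊔ z := by
    rw [inf_comm, inf_sup_assoc_of_le y le_sup_right, hyz', inf_eq_left, ← hxz']
    exact sup_le_sup_right hhx z
  have s3' : (z ⊓ (h ⊔ y)) ⊔ y = h ⊔ y := by
    rw [inf_comm, inf_sup_assoc_of_le z le_sup_right, sup_comm z, hyz', inf_eq_left, ← hxy']
    exact sup_le_sup_right hhx y
  have s4 : y ⊓ (h ⊔ z) ⊔ z ⊓ (h ⊔ y) = (h ⊔ y) ⊓ (h ⊔ z) := by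
    rw [← sup_inf_assoc_of_le z (inf_le_left.trans le_sup_right : y ⊓ (h ⊔ z) ≤ h ⊔ y), s3,
      inf_comm]
  have i1 : h ⊓ (y ⊓ (h ⊔ z)) = u := by
    rw [← inf_assoc, hhy, inf_eq_left]; exact huh.le.trans le_sup_left
  have i2 : h ⊓ (z ⊓ (h ⊔ y)) = u := by
    rw [← inf_assoc, hhz, inf_eq_left]; exact huh.le.trans le_sup_left
  have i3 : y ⊓ (h ⊔ z) ⊓ z = u := by
    rw [inf_right_comm, hyz, inf_eq_left]; exact huh.le.trans le_sup_left
  have i3' : z ⊓ (h ⊔ y) ⊓ y = u := by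
    rw [inf_right_comm, inf_comm z, hyz, inf_eq_left]; exact huh.le.trans le_sup_left
  have c1 : u ⋖ y ⊓ (h ⊔ z) := by
    have hc : z ⋖ h ⊔ z := covBy_sup_of_inf_covBy_left (hhz.symm ▸ huh)
    rw [← s3] at hc
    have := inf_covBy_of_covBy_sup_right hc
    rwa [i3] at this
  have c2 : u ⋖ z ⊓ (h ⊔ y) := by
    have hc : y ⋖ h ⊔ y := covBy_sup_of_inf_covBy_left (hhy.symm ▸ huh)
    rw [← s3'] at hc
    have := inf_covBy_of_covBy_sup_right hc
    rwa [i3'] at this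
  refine ⟨h, y ⊓ (h ⊔ z), z ⊓ (h ⊔ y), huh, c1, c2, i1, i2, ?_, by rw [s1, s2], by rw [s4, s1]⟩
  refine le_antisymm ?_ (le_inf c1.le c2.le)
  rw [← i3]
  exact inf_le_inf_left _ inf_le_left

/-- A finite modular lattice that is not distributive contains a diamond `k ⋖ x, y, z` whose
atoms have the same pairwise joins. -/
theorem exists_diamond [Finite L] (h : ¬ IsDistributive L) :
    ∃ k x y z : L, k ⋖ x ∧ k ⋖ y ∧ k ⋖ z ∧
      x ⊓ y = k ∧ x ⊓ z = k ∧ y ⊓ z = k ∧ x ⊔ z = x ⊔ y ∧ y ⊔ z = x ⊔ y := by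
  unfold IsDistributive at h
  push Not at h
  obtain ⟨a, b, c, habc⟩ := h
  have i1 := diamond_inf a b c
  have i2 := diamond_inf a c b
  have i3 := diamond_inf b c a
  have s1 := diamond_sup a b c
  have s2 := diamond_sup a c b
  have s3 := diamond_sup b c a
  rw [inf_comm c b, sup_comm c b, sup_comm (a ⊓ c)] at i2
  rw [inf_comm c b, sup_comm c b, inf_comm (a ⊔ c)] at s2
  rw [inf_comm c a, sup_comm c a, inf_comm b a, sup_comm b a, sup_comm (b ⊓ c), sup_right_comm] at i3
  rw [inf_comm c a, sup_comm c a, inf_comm b a, sup_comm b a, inf_comm (b ⊔ c), inf_right_comm] at s3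
  refine ⟨_, exists_covBy_diamond ?_ i1 i2 i3 s1 s2 s3⟩
  -- if bottom and top of the diamond agree, meeting them with `a` gives distributivity at `a, b, c`
  intro e
  apply habc
  have h1 : a ⊓ ((a ⊔ b) ⊓ (a ⊔ c) ⊓ (b ⊔ c)) = a ⊓ (b ⊔ c) := by
    rw [← inf_assoc, ← inf_assoc, inf_sup_self, inf_sup_self]
  have h2 : a ⊓ ((a ⊓ b) ⊔ (a ⊓ c) ⊔ (b ⊓ c)) = (a ⊓ b) ⊔ (a ⊓ c) := by
    rw [inf_comm, sup_inf_assoc_of_le _ (sup_le inf_le_left inf_le_left), sup_eq_left]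
    exact le_sup_of_le_left (le_inf inf_le_right (inf_le_left.trans inf_le_left))
  rw [← h1, ← h2, e]

end Lattice

/-! ### Lattices of pairwise permuting subgroups -/

section PiResidual

variable {G : Type*} [Group G] {π : Set Nat.Primes} {A B C S T : Subgroup G}

theorem le_normalizer_closure {X : Set G}
    (h : ∀ b ∈ B, ∀ x ∈ X, b * x * b⁻¹ ∈ Subgroup.closure X) :
    B ≤ Subgroup.normalizer (Subgroup.closure X : Set G) :=
  le_normalizer_of_forall fun b hb a ha => by
    have : Subgroup.closure X ≤ (Subgroup.closure X).comap (MulAut.conj b).toMonoidHom :=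
      (Subgroup.closure_le _).2 fun x hx => by simpa using h b hb x hx
    simpa using this ha

theorem le_normalizer_sSup {X : Set (Subgroup G)}
    (h : ∀ b ∈ B, ∀ U ∈ X, MulAut.conj b • U ≤ sSup X) :
    B ≤ Subgroup.normalizer ((sSup X : Subgroup G) : Set G) :=
  le_normalizer_of_forall fun b hb a ha => by
    have : sSup X ≤ MulAut.conj b⁻¹ • sSup X := sSup_le fun U hU => by
      rw [Subgroup.subset_pointwise_smul_iff, map_inv, inv_inv]
      exact h b hb U hU
    simpa using mem_conj_smul.1 (this ha)

/-- The subgroup `O^π(A)` of `A`, described as the subgroup generated by all `π'`-elements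
of `A`. -/
def piResidual (π : Set Nat.Primes) (A : Subgroup G) : Subgroup G :=
  Subgroup.closure {x | x ∈ A ∧ IsPiNumber πᶜ (orderOf x)}

theorem mem_piResidual {x : G} (hx : x ∈ A) (h : IsPiNumber πᶜ (orderOf x)) :
    x ∈ piResidual π A :=
  Subgroup.subset_closure ⟨hx, h⟩

theorem piResidual_le : piResidual π A ≤ A :=
  (Subgroup.closure_le _).2 fun _ hx => hx.1

theorem piResidual_mono (h : A ≤ B) : piResidual π A ≤ piResidual π B :=
  Subgroup.closure_mono fun _ hx => ⟨h hx.1, hx.2⟩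

theorem le_normalizer_piResidual_of (h : ∀ b ∈ B, ∀ x ∈ A, IsPiNumber πᶜ (orderOf x) →
    b * x * b⁻¹ ∈ A) : B ≤ Subgroup.normalizer (piResidual π A : Set G) :=
  le_normalizer_closure fun b hb x hx =>
    mem_piResidual (h b hb x hx.1 hx.2) (by rw [orderOf_conj]; exact hx.2)

theorem le_normalizer_piResidual (h : B ≤ Subgroup.normalizer (A : Set G)) :
    B ≤ Subgroup.normalizer (piResidual π A : Set G) :=
  le_normalizer_piResidual_of fun _ hb _ hx _ => conj_mem_of_mem_normalizer (h hb) hx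

theorem conj_smul_piResidual_le (g : G) :
    MulAut.conj g • piResidual π A ≤ piResidual π (MulAut.conj g • A) := by
  rw [Subgroup.pointwise_smul_subset_iff]
  refine (Subgroup.closure_le _).2 fun x hx => ?_
  rw [SetLike.mem_coe, ← map_inv, mem_conj_smul, inv_inv]
  refine mem_piResidual ?_ (by rw [orderOf_conj]; exact hx.2)
  rw [mem_conj_smul]
  simpa [mul_assoc] using hx.1

/-- `|C : C ∩ S|` divides `|A : A ∩ S|` for a normal subgroup `C` of `A`. -/
theorem relIndex_dvd_of_le_normalizer (hCA : C ≤ A)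
    (h : A ≤ Subgroup.normalizer (C : Set G)) : S.relIndex C ∣ S.relIndex A := by
  have hp : Permute C (S ⊓ A) := permute_of_le_normalizer (inf_le_right.trans h)
  have h1 : (S ⊓ A).relIndex C = S.relIndex C := by
    rw [← Subgroup.inf_relIndex_right, inf_assoc, inf_eq_right.2 hCA, Subgroup.inf_relIndex_right]
  rw [← h1, ← hp.relIndex_sup, ← Subgroup.inf_relIndex_right S A,
    ← Subgroup.relIndex_mul_relIndex _ _ _ le_sup_right (sup_le hCA inf_le_right)]
  exact dvd_mul_right _ _

/-- If the `π`-elements of `C` commute with its elements of prime power order prime to `π`, then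
a Hall `π`-subgroup of `C` contains all `π`-elements of `C`. -/
theorem mem_hall_of_commute [Finite G] (hT : IsPiSubgroup π T)
    (hi : IsPiNumber πᶜ (T.relIndex C))
    (h : ∀ x ∈ C, ∀ y ∈ C, IsPiNumber π (orderOf x) →
      (∃ (p : Nat.Primes) (k : ℕ), p ∉ π ∧ orderOf y = (p : ℕ) ^ k) → x * y = y * x)
    {x : G} (hx : x ∈ C) (hxπ : IsPiNumber π (orderOf x)) : x ∈ T := by
  refine mem_of_normal_hall (A := C) ?_ hi hx hxπ
  refine Subgroup.relIndex_eq_one.1 (eq_one_of_forall_not_dvd fun p hp => ?_)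
  by_cases hpπ : p ∈ π
  · refine hi p (hp.trans ?_) hpπ
    rw [← Subgroup.inf_relIndex_right T]
    exact Subgroup.relIndex_dvd_of_le_left _ Subgroup.le_normalizer
  · refine not_dvd_relIndex p.2 (fun y hy k hk => ?_) hp
    refine Subgroup.mem_normalizer_iff.2 fun z => ?_
    have hc : ∀ z, z ∈ T ⊓ C → y * z * y⁻¹ = z := fun z hz => by
      rw [← h z hz.2 y hy (hT.orderOf hz.1) ⟨p, k, hpπ, hk⟩, mul_inv_cancel_right]
    constructor
    · intro hz
      rwa [hc z hz]
    · intro hz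
      have h1 := h _ hz.2 y hy (hT.orderOf hz.1) ⟨p, k, hpπ, hk⟩
      have h2 : z = y * z * y⁻¹ := by
        rw [inv_mul_cancel_right, mul_assoc, mul_right_inj] at h1
        rwa [mul_assoc]
      rwa [h2]

end PiResidual

/-- A conjugation invariant lattice of pairwise permuting subgroups that contains all normal
subgroups, together with conjugation invariant nonempty families of Hall `s`-subgroups, `s ∈ σ`,
permuting with all its members. The families need not contain all Hall subgroups, so that the
notion passes to quotients. -/
structure PermutingLattice (σ : Set (Set Nat.Primes)) (G : Type*) [Group G] where
  /-- The members of the lattice. -/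
  carrier : Set (Subgroup G)
  /-- The distinguished Hall `s`-subgroups. -/
  hall : Set Nat.Primes → Set (Subgroup G)
  sup_mem : ∀ {A B : Subgroup G}, A ∈ carrier → B ∈ carrier → A ⊔ B ∈ carrier
  inf_mem : ∀ {A B : Subgroup G}, A ∈ carrier → B ∈ carrier → A ⊓ B ∈ carrier
  conj_mem : ∀ (g : G) {A : Subgroup G}, A ∈ carrier → MulAut.conj g • A ∈ carrier
  normal_mem : ∀ (N : Subgroup G), N.Normal → N ∈ carrier
  permute : ∀ {A B : Subgroup G}, A ∈ carrier → B ∈ carrier → Permute A B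
  hall_nonempty : ∀ {s : Set Nat.Primes}, s ∈ σ → (hall s).Nonempty
  isHall : ∀ {s : Set Nat.Primes} {H : Subgroup G}, H ∈ hall s → IsHall s H
  hall_conj : ∀ (g : G) {s : Set Nat.Primes} {H : Subgroup G}, H ∈ hall s →
    MulAut.conj g • H ∈ hall s
  permute_hall : ∀ {A : Subgroup G}, A ∈ carrier → ∀ {s : Set Nat.Primes}, s ∈ σ →
    ∀ {H : Subgroup G}, H ∈ hall s → Permute A H

namespace PermutingLattice

variable {G : Type*} [Group G] {σ : Set (Set Nat.Primes)}

/-- The lattice of `σ`-permutable subgroups, if these permute pairwise. -/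
def ofConditionI [Finite G] (hG : IsFull σ G) (h : ConditionI σ G) : PermutingLattice σ G where
  carrier := {A | IsPermutable σ A}
  hall s := {H | IsHall s H}
  sup_mem hA hB := isPermutable_sup hA hB
  inf_mem hA hB := IsPermutable.inf hA hB (h ⟨_, hA⟩ ⟨_, hB⟩)
  conj_mem g _ hA := IsPermutable.smul hA g
  normal_mem N _ := isPermutable_of_normal hG N
  permute hA hB := h ⟨_, hA⟩ ⟨_, hB⟩
  hall_nonempty hs := hG.exists_isHall hs
  isHall hH := hH
  hall_conj g _ _ hH := IsHall.smul hH g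
  permute_hall hA _ hs H hH := hA.2 _ hs H hH

theorem map_conj_smul {G' : Type*} [Group G'] (f : G →* G') (g : G) (A : Subgroup G) :
    (MulAut.conj g • A).map f = MulAut.conj (f g) • A.map f := by
  ext x
  simp only [Subgroup.mem_map, mem_conj_smul]
  constructor
  · rintro ⟨y, hy, rfl⟩
    exact ⟨_, hy, by simp⟩
  · rintro ⟨y, hy, e⟩
    exact ⟨g * y * g⁻¹, by simpa [mul_assoc] using hy, by simp [e, mul_assoc]⟩

theorem comap_conj_smul {G' : Type*} [Group G'] (f : G →* G') (g : G) (A : Subgroup G') :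
    (MulAut.conj (f g) • A).comap f = MulAut.conj g • A.comap f := by
  ext x
  simp [mem_conj_smul]

/-- The induced lattice of subgroups of a quotient of `G`. -/
def quotient (𝓛 : PermutingLattice σ G) (R : Subgroup G) [R.Normal] :
    PermutingLattice σ (G ⧸ R) where
  carrier := {A | A.comap (QuotientGroup.mk' R) ∈ 𝓛.carrier}
  hall s := (fun H => H.map (QuotientGroup.mk' R)) '' 𝓛.hall s
  sup_mem hA hB := by
    rw [Set.mem_ofPred_eq, ← Subgroup.comap_sup_eq _ _ _ (QuotientGroup.mk'_surjective R)]
    exact 𝓛.sup_mem hA hB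
  inf_mem hA hB := by
    rw [Set.mem_ofPred_eq, Subgroup.comap_inf]
    exact 𝓛.inf_mem hA hB
  conj_mem g A hA := by
    obtain ⟨g, rfl⟩ := QuotientGroup.mk'_surjective R g
    rw [Set.mem_ofPred_eq, comap_conj_smul]
    exact 𝓛.conj_mem g hA
  normal_mem N hN := 𝓛.normal_mem _ (hN.comap _)
  permute {A B} hA hB := by
    have := (𝓛.permute hA hB).map (QuotientGroup.mk' R)
    rwa [Subgroup.map_comap_eq_self_of_surjective (QuotientGroup.mk'_surjective R),
      Subgroup.map_comap_eq_self_of_surjective (QuotientGroup.mk'_surjective R)] at this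
  hall_nonempty hs := (𝓛.hall_nonempty hs).image _
  isHall := by
    rintro s _ ⟨H, hH, rfl⟩
    exact (𝓛.isHall hH).map (QuotientGroup.mk'_surjective R)
  hall_conj g := by
    rintro s _ ⟨H, hH, rfl⟩
    obtain ⟨g, rfl⟩ := QuotientGroup.mk'_surjective R g
    exact ⟨_, 𝓛.hall_conj g hH, map_conj_smul _ g H⟩
  permute_hall {A} hA s hs := by
    rintro _ ⟨H, hH, rfl⟩
    have := (𝓛.permute_hall hA hs hH).map (QuotientGroup.mk' R)
    rwa [Subgroup.map_comap_eq_self_of_surjective (QuotientGroup.mk'_surjective R)] at this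

variable (𝓛 : PermutingLattice σ G) {A B C H K L : Subgroup G} {s t : Set Nat.Primes}

theorem isPiNumber_relIndex (hA : A ∈ 𝓛.carrier) (hs : s ∈ σ) (hH : H ∈ 𝓛.hall s) :
    IsPiNumber sᶜ (H.relIndex A) :=
  (𝓛.isHall hH).relIndex (𝓛.permute_hall hA hs hH)

/-- `B` covers `A` in the lattice `𝓛`. -/
def Covers (A B : Subgroup G) : Prop :=
  A < B ∧ ∀ C ∈ 𝓛.carrier, A ≤ C → C ≤ B → C = A ∨ C = B

variable {𝓛}

/-- Members of a lattice of permuting subgroups are normal in their covers: otherwise the cover is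
a product of two conjugates of the subgroup. -/
theorem Covers.le_normalizer (h : 𝓛.Covers A B) (hA : A ∈ 𝓛.carrier) :
    B ≤ Subgroup.normalizer (A : Set G) := by
  refine le_normalizer_of_forall fun b hb a ha => ?_
  have hAb := 𝓛.conj_mem b hA
  have hle : MulAut.conj b • A ≤ B := Subgroup.conj_smul_le_of_le h.1.le ⟨b, hb⟩
  have hmem : b * a * b⁻¹ ∈ MulAut.conj b • A := mem_conj_smul.2 (by simpa [mul_assoc] using ha)
  rcases h.2 _ (𝓛.sup_mem hAb hA) le_sup_right (sup_le hle h.1.le) with e | e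
  · rw [← e]
    exact Subgroup.mem_sup_left hmem
  · exfalso
    obtain ⟨c, hc, a', ha', e'⟩ := (𝓛.permute hAb hA).exists_of_mem_sup (e ▸ hb)
    have hc' := mem_conj_smul.1 hc
    have hbA : b ∈ A := by
      have h1 : b⁻¹ * c * b = a'⁻¹ * b := by
        rw [e']; group
      rw [h1] at hc'
      simpa using mul_mem ha' hc'
    rw [Subgroup.conj_smul_eq_self_of_mem hbA, sup_idem] at e
    exact h.1.ne e

/-- In a diamond, the top covers the atoms. -/
theorem Covers.sup (h : 𝓛.Covers K L) (hH : H ∈ 𝓛.carrier) (hL : L ∈ 𝓛.carrier)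
    (hHL : H ⊓ L = K) : 𝓛.Covers H (H ⊔ L) := by
  refine ⟨lt_of_le_of_ne le_sup_left fun e => ?_, fun C hC hHC hCV => ?_⟩
  · have : L ≤ H := e ▸ le_sup_right
    rw [inf_eq_right.2 this] at hHL
    exact h.1.ne hHL.symm
  · have hC' : C ≤ H ⊔ (L ⊓ C) :=
      (le_inf hCV le_rfl).trans ((𝓛.permute hH hL).sup_inf_le hHC)
    rcases h.2 _ (𝓛.inf_mem hL hC) (le_inf h.1.le (hHL ▸ inf_le_left.trans hHC))
      inf_le_left with e | e
    · left
      rw [e, sup_eq_left.2 (hHL ▸ inf_le_left)] at hC'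
      exact le_antisymm hC' hHC
    · right
      exact le_antisymm hCV (sup_le hHC (inf_eq_left.1 e))

variable (𝓛)

/-- Every proper member is normal in a larger member; in particular, members are subnormal. -/
theorem exists_lt_le_normalizer [Finite G] (hA : A ∈ 𝓛.carrier) (hne : A ≠ ⊤) :
    ∃ B ∈ 𝓛.carrier, A < B ∧ B ≤ Subgroup.normalizer (A : Set G) := by
  obtain ⟨B, hB⟩ := (Set.toFinite {B | B ∈ 𝓛.carrier ∧ A < B}).exists_minimal
    ⟨⊤, 𝓛.normal_mem _ inferInstance, hne.lt_top⟩
  refine ⟨B, hB.prop.1, hB.prop.2, Covers.le_normalizer (𝓛 := 𝓛) ⟨hB.prop.2, ?_⟩ hA⟩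
  intro C hC hAC hCB
  rcases hAC.eq_or_lt with e | hlt
  · exact Or.inl e.symm
  · exact Or.inr (le_antisymm hCB (hB.le_of_le ⟨hC, hlt⟩ hCB))

/-- If `T` is a Hall `t`-subgroup, then all `t'`-elements of `AT` lie in `A`, because `A` is
subnormal. -/
theorem mem_of_mem_sup_hall [Finite G] (ht : t ∈ σ) {T : Subgroup G} (hT : T ∈ 𝓛.hall t) {x : G}
    (hxt : IsPiNumber tᶜ (orderOf x)) :
    ∀ (n : ℕ) (A : Subgroup G), A ∈ 𝓛.carrier → A.index = n → x ∈ A ⊔ T → x ∈ A := by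
  intro n
  induction n using Nat.strong_induction_on with
  | _ n ih =>
  intro A hA hn hx
  by_cases hne : A = ⊤
  · rw [hne]; trivial
  obtain ⟨B, hB, hAB, hBA⟩ := 𝓛.exists_lt_le_normalizer hA hne
  have hxB : x ∈ B := ih B.index (hn ▸ Subgroup.index_strictAnti hAB) B hB rfl
    (sup_le_sup_right hAB.le T hx)
  have hx' : x ∈ A ⊔ (T ⊓ B) := (𝓛.permute_hall hA ht hT).sup_inf_le hAB.le ⟨hx, hxB⟩
  have hle : A ⊔ (T ⊓ B) ≤ Subgroup.normalizer (A : Set G) :=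
    sup_le Subgroup.le_normalizer (inf_le_right.trans hBA)
  refine mem_of_coprime_relIndex (A := A ⊔ (T ⊓ B)) ?_ hx' ?_
  · rwa [inf_eq_left.2 (le_sup_left : A ≤ A ⊔ T ⊓ B)]
  · have hp : Permute (T ⊓ B) A := (permute_of_le_normalizer (inf_le_right.trans hBA)).symm
    rw [sup_comm, hp.relIndex_sup]
    refine Nat.Coprime.symm (IsPiNumber.coprime (π := t) ?_ hxt)
    exact IsPiNumber.of_dvd ((𝓛.isHall hT).1.mono inf_le_left) (Subgroup.relIndex_dvd_card _ _)

/-- Hall `t`-subgroups normalize `O^t(A)`. -/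
theorem hall_le_normalizer_piResidual [Finite G] (hA : A ∈ 𝓛.carrier) (ht : t ∈ σ)
    {T : Subgroup G} (hT : T ∈ 𝓛.hall t) :
    T ≤ Subgroup.normalizer (piResidual t A : Set G) :=
  le_normalizer_piResidual_of fun b hb x hx hxt =>
    𝓛.mem_of_mem_sup_hall ht hT (by rwa [orderOf_conj]) _ A hA rfl
      (mul_mem (mul_mem (Subgroup.mem_sup_right hb) (Subgroup.mem_sup_left hx))
        (inv_mem (Subgroup.mem_sup_right hb)))

/-- The intersection of all distinguished Hall `s`-subgroups. -/
def core (s : Set Nat.Primes) : Subgroup G := sInf (𝓛.hall s)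

instance core_normal (s : Set Nat.Primes) : (𝓛.core s).Normal := by
  refine ⟨fun n hn g => ?_⟩
  rw [core, Subgroup.mem_sInf] at hn ⊢
  intro H hH
  have := mem_conj_smul.1 (hn _ (𝓛.hall_conj g⁻¹ hH))
  simpa using this

theorem isPiSubgroup_core (hs : s ∈ σ) : IsPiSubgroup s (𝓛.core s) := by
  obtain ⟨H, hH⟩ := 𝓛.hall_nonempty hs
  exact (𝓛.isHall hH).1.mono (sInf_le hH)

theorem eq_top_of_hall_le (hσ : Setoid.IsPartition σ) {Z : Subgroup G}
    (h : ∀ s ∈ σ, ∀ H ∈ 𝓛.hall s, H ≤ Z) : Z = ⊤ :=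
  SigmaGroup.eq_top_of_hall_le hσ fun s hs =>
    let ⟨H, hH⟩ := 𝓛.hall_nonempty hs
    ⟨H, h s hs H hH, 𝓛.isHall hH⟩

theorem normal_of_hall_le_normalizer (hσ : Setoid.IsPartition σ) {Z : Subgroup G}
    (h : ∀ s ∈ σ, ∀ H ∈ 𝓛.hall s, H ≤ Subgroup.normalizer (Z : Set G)) : Z.Normal :=
  Subgroup.normalizer_eq_top_iff.1 (𝓛.eq_top_of_hall_le hσ h)

end PermutingLattice

/-! ### Members of the lattice are `σ`-nilpotent modulo their cores -/

namespace PermutingLattice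

variable {G : Type*} [Group G] {σ : Set (Set Nat.Primes)} (𝓛 : PermutingLattice σ G)
  {A B C H K L M : Subgroup G} {s t : Set Nat.Primes}

/-- A member of `𝓛` with trivial normal core has no nontrivial subgroup `U` such that
`O^s(U) = U` for all blocks `s`: the largest such subgroup lies in `O^t(A)`, hence is normalized
by the Hall `t`-subgroups, for every `t`. -/
theorem eq_bot_of_piResidual_eq [Finite G] (hσ : Setoid.IsPartition σ) (hA : A ∈ 𝓛.carrier)
    (hcore : ∀ N : Subgroup G, N.Normal → N ≤ A → N = ⊥) {U : Subgroup G} (hUA : U ≤ A)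
    (hU : ∀ s ∈ σ, piResidual s U = U) : U = ⊥ := by
  let X : Set (Subgroup G) := {U | U ≤ A ∧ ∀ s ∈ σ, piResidual s U = U}
  have hXn : (sSup X).Normal := 𝓛.normal_of_hall_le_normalizer hσ fun t ht T hT => by
    refine le_normalizer_sSup fun b hb U hU => le_sSup ⟨?_, fun s hs => ?_⟩
    · rw [← hU.2 t ht]
      refine le_trans ?_ (piResidual_le (π := t) (A := A))
      intro x hx
      have hn := 𝓛.hall_le_normalizer_piResidual hA ht hT hb
      have := conj_mem_of_mem_normalizer hn (piResidual_mono hU.1 (mem_conj_smul.1 hx))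
      simpa [mul_assoc] using this
    · refine le_antisymm piResidual_le ?_
      conv_lhs => rw [← hU.2 s hs]
      exact conj_smul_piResidual_le b
  have := hcore _ hXn (sSup_le fun U hU => hU.1)
  exact le_bot_iff.1 (this ▸ le_sSup ⟨hUA, hU⟩)

theorem inf_core_eq (s t : Set Nat.Primes) (hσ : Setoid.IsPartition σ) (hs : s ∈ σ) (ht : t ∈ σ)
    (hst : s ≠ t) : A ⊓ 𝓛.core s = piResidual t A ⊓ 𝓛.core s :=
  le_antisymm (le_inf (fun _ hx => mem_piResidual hx.1
    (((𝓛.isPiSubgroup_core hs).orderOf hx.2).mono (block_subset_compl hσ ht hs hst.symm)))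
    inf_le_right) (inf_le_inf_right _ piResidual_le)

/-- If `A` has trivial normal core, then `O^s(A) ∩ O_s(G)` is trivial: it is normalized by the
Hall `s`-subgroups, and its conjugates under the normalizer of `A ∩ O_s(G)`, which contains all
other Hall subgroups, lie in `A`. -/
theorem piResidual_inf_core_eq_bot [Finite G] (hσ : Setoid.IsPartition σ) (hA : A ∈ 𝓛.carrier)
    (hcore : ∀ N : Subgroup G, N.Normal → N ≤ A → N = ⊥) (hs : s ∈ σ) :
    piResidual s A ⊓ 𝓛.core s = ⊥ := by
  let Q := A ⊓ 𝓛.core s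
  let J := piResidual s A ⊓ 𝓛.core s
  let X : Set (Subgroup G) :=
    (fun x => MulAut.conj x • J) '' {x | x ∈ Subgroup.normalizer (Q : Set G)}
  have hJQ : J ≤ Q := inf_le_inf_right _ piResidual_le
  have hXQ : sSup X ≤ Q := by
    refine sSup_le ?_
    rintro _ ⟨x, hx, rfl⟩
    intro y hy
    have := conj_mem_of_mem_normalizer hx (hJQ (mem_conj_smul.1 hy))
    simpa [mul_assoc] using this
  have hXn : (sSup X).Normal := 𝓛.normal_of_hall_le_normalizer hσ fun t ht T hT => by
    refine le_normalizer_sSup ?_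
    rintro b hb _ ⟨x, hx, rfl⟩
    by_cases hst : s = t
    · subst hst
      have hb' : x⁻¹ * b * x ∈ MulAut.conj x⁻¹ • T := by
        rw [mem_conj_smul]
        simpa [mul_assoc] using hb
      have hn : x⁻¹ * b * x ∈ Subgroup.normalizer (J : Set G) := le_normalizer_inf
        (𝓛.hall_le_normalizer_piResidual hA hs (𝓛.hall_conj x⁻¹ hT)) le_normalizer_of_normal hb'
      refine le_trans ?_ (le_sSup ⟨x, hx, rfl⟩)
      intro y hy
      rw [mem_conj_smul, mem_conj_smul] at hy
      rw [mem_conj_smul]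
      have := conj_mem_of_mem_normalizer hn hy
      simpa [mul_assoc] using this
    · have hbQ : b ∈ Subgroup.normalizer (Q : Set G) := by
        have h1 : T ≤ Subgroup.normalizer (Q : Set G) := by
          rw [show Q = _ from 𝓛.inf_core_eq s t hσ hs ht hst]
          exact le_normalizer_inf (𝓛.hall_le_normalizer_piResidual hA ht hT)
            le_normalizer_of_normal
        exact h1 hb
      rw [smul_smul, ← map_mul]
      exact le_sSup ⟨b * x, mul_mem hbQ hx, rfl⟩
  have h0 := hcore _ hXn (hXQ.trans inf_le_left)
  have hJX : J ≤ sSup X := le_sSup ⟨1, (Subgroup.normalizer (Q : Set G)).one_mem, by simp⟩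
  exact le_bot_iff.1 (h0 ▸ hJX)

/-- Normal subgroups `B` of a member `A` of `𝓛` with trivial normal core are `σ`-nilpotent, by
induction on `|B|`. Some `C = O^s(B)` is a proper subgroup of `B`; it is `σ`-nilpotent by induction
and contains the `r`-elements of `B` for `r ≠ s`, which therefore lie in `O_r(G)`. So their
commutators with `r'`-elements lie in the trivial group `O^r(A) ∩ O_r(G)`. -/
theorem commute_of_core_eq_bot_aux [Finite G] (hσ : Setoid.IsPartition σ) (hA : A ∈ 𝓛.carrier)
    (hcore : ∀ N : Subgroup G, N.Normal → N ≤ A → N = ⊥) :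
    ∀ (n : ℕ) (B : Subgroup G), B ≤ A → A ≤ Subgroup.normalizer (B : Set G) → Nat.card B = n →
      ∀ s ∈ σ, ∀ r ∈ σ, s ≠ r → ∀ x ∈ B, ∀ y ∈ B, IsPiNumber s (orderOf x) →
        IsPiNumber r (orderOf y) → x * y = y * x := by
  intro n
  induction n using Nat.strong_induction_on with
  | _ n ih =>
  intro B hBA hAB hn
  by_cases hB : ∀ s ∈ σ, piResidual s B = B
  · have h0 := 𝓛.eq_bot_of_piResidual_eq hσ hA hcore hBA hB
    intro s _ r _ _ x hx y hy _ _
    rw [h0, Subgroup.mem_bot] at hx hy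
    rw [hx, hy]
  push Not at hB
  obtain ⟨s₀, hs₀, hne⟩ := hB
  let C := piResidual s₀ B
  have hCB : C ≤ B := piResidual_le
  have hAC : A ≤ Subgroup.normalizer (C : Set G) := le_normalizer_piResidual hAB
  have ihC := ih (Nat.card C)
    (hn ▸ Set.Finite.card_lt_card (Set.toFinite _) (lt_of_le_of_ne hCB hne : C < B))
    C (hCB.trans hBA) hAC rfl
  have key : ∀ s ∈ σ, ∀ r ∈ σ, s ≠ r → r ≠ s₀ → ∀ x ∈ B, ∀ y ∈ B, IsPiNumber s (orderOf x) →
      IsPiNumber r (orderOf y) → x * y = y * x := by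
    intro s hs r hr hsr hr0 x hx y hy hxs hyr
    have hyC : y ∈ C := mem_piResidual hy (hyr.mono (block_subset_compl hσ hs₀ hr hr0.symm))
    -- by induction `C` is `σ`-nilpotent, so that `y` lies in all Hall `r`-subgroups
    have hyO : y ∈ 𝓛.core r := by
      rw [core, Subgroup.mem_sInf]
      intro T hT
      refine mem_hall_of_commute (C := C) (𝓛.isHall hT).1
        ((𝓛.isPiNumber_relIndex hA hr hT).of_dvd
          (relIndex_dvd_of_le_normalizer (hCB.trans hBA) hAC)) ?_ hyC hyr
      rintro z hz w hw hzr ⟨p, k, hp, hk⟩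
      obtain ⟨t, ht, hpt⟩ := exists_block hσ p
      refine ihC r hr t ht (fun e => hp (e ▸ hpt)) z hz w hw hzr ?_
      rw [hk]
      exact isPiNumber_prime_pow hpt k
    have hxE : x ∈ piResidual r A :=
      mem_piResidual (hBA hx) (hxs.mono (block_subset_compl hσ hr hs hsr.symm))
    have hyA : y ∈ A := hBA hy
    have h1 : x * y * x⁻¹ * y⁻¹ ∈ piResidual r A ⊓ 𝓛.core r := by
      refine ⟨?_, ?_⟩
      · have hyn := le_normalizer_piResidual (π := r) (Subgroup.le_normalizer (H := A)) hyA
        have := mul_mem hxE (conj_mem_of_mem_normalizer hyn (inv_mem hxE))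
        simpa [mul_assoc] using this
      · exact (𝓛.core r).mul_mem ((𝓛.core_normal r).conj_mem y hyO x) ((𝓛.core r).inv_mem hyO)
    rw [𝓛.piResidual_inf_core_eq_bot hσ hA hcore hr, Subgroup.mem_bot] at h1
    rw [mul_inv_eq_one, mul_inv_eq_iff_eq_mul] at h1
    exact h1
  intro s hs r hr hsr x hx y hy hxs hyr
  by_cases hr0 : r = s₀
  · exact (key r hr s hs hsr.symm (fun e => hsr (e.trans hr0.symm)) y hy x hx hyr hxs).symm
  · exact key s hs r hr hsr hr0 x hx y hy hxs hyr

/-- Elements of a member of `𝓛` with orders belonging to distinct blocks commute modulo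
the normal core. -/
theorem commutator_mem_normalCore [Finite G] (hσ : Setoid.IsPartition σ) (hA : A ∈ 𝓛.carrier)
    (hs : s ∈ σ) (ht : t ∈ σ) (hst : s ≠ t) {x y : G} (hx : x ∈ A) (hy : y ∈ A)
    (hxs : IsPiNumber s (orderOf x)) (hyt : IsPiNumber t (orderOf y)) :
    x * y * x⁻¹ * y⁻¹ ∈ A.normalCore := by
  let f := QuotientGroup.mk' A.normalCore
  have hf : Function.Surjective f := QuotientGroup.mk'_surjective _
  have hcomap : (A.map f).comap f = A := Subgroup.comap_map_eq_self (by
    rw [QuotientGroup.ker_mk']; exact A.normalCore_le)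
  have hA' : A.map f ∈ (𝓛.quotient A.normalCore).carrier := by
    change (A.map f).comap f ∈ 𝓛.carrier
    rwa [hcomap]
  have h := (𝓛.quotient A.normalCore).commute_of_core_eq_bot_aux hσ hA' (fun N hN hNA => ?_) _
    (A.map f) le_rfl Subgroup.le_normalizer rfl s hs t ht hst (f x) (Subgroup.mem_map_of_mem f hx)
    (f y) (Subgroup.mem_map_of_mem f hy) (hxs.of_dvd (orderOf_map_dvd f x))
    (hyt.of_dvd (orderOf_map_dvd f y))
  · rw [← QuotientGroup.eq_one_iff]
    change f (x * y * x⁻¹ * y⁻¹) = 1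
    rw [map_mul, map_mul, map_mul, h, ← map_mul, ← map_mul, ← map_mul]
    simp
  · have h1 : (N.comap f).Normal := hN.comap f
    have h2 : N.comap f ≤ A.normalCore :=
      Subgroup.normal_le_normalCore.2 ((Subgroup.comap_mono hNA).trans hcomap.le)
    rw [eq_bot_iff]
    intro z hz
    obtain ⟨g, rfl⟩ := hf z
    rw [Subgroup.mem_bot]
    exact (QuotientGroup.eq_one_iff g).2 (h2 hz)

/-! ### Diamonds in lattices of permuting subgroups -/

/-- A diamond in `𝓛` whose atoms `H`, `L`, `M` cover its bottom `K`. -/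
structure IsDiamond (K H L M : Subgroup G) : Prop where
  bot_mem : K ∈ 𝓛.carrier
  mem₁ : H ∈ 𝓛.carrier
  mem₂ : L ∈ 𝓛.carrier
  mem₃ : M ∈ 𝓛.carrier
  covers₁ : 𝓛.Covers K H
  covers₂ : 𝓛.Covers K L
  covers₃ : 𝓛.Covers K M
  inf₁₂ : H ⊓ L = K
  inf₁₃ : H ⊓ M = K
  inf₂₃ : L ⊓ M = K
  sup₁₃ : H ⊔ M = H ⊔ L
  sup₂₃ : L ⊔ M = H ⊔ L

namespace IsDiamond

variable {𝓛}

theorem swap₁₂ (h : 𝓛.IsDiamond K H L M) : 𝓛.IsDiamond K L H M :=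
  ⟨h.bot_mem, h.mem₂, h.mem₁, h.mem₃, h.covers₂, h.covers₁, h.covers₃, inf_comm H L ▸ h.inf₁₂,
    h.inf₂₃, h.inf₁₃, h.sup₂₃.trans (sup_comm _ _), h.sup₁₃.trans (sup_comm _ _)⟩

theorem swap₂₃ (h : 𝓛.IsDiamond K H L M) : 𝓛.IsDiamond K H M L :=
  ⟨h.bot_mem, h.mem₁, h.mem₃, h.mem₂, h.covers₁, h.covers₃, h.covers₂, h.inf₁₃, h.inf₁₂,
    inf_comm L M ▸ h.inf₂₃, h.sup₁₃.symm, (sup_comm M L).trans (h.sup₂₃.trans h.sup₁₃.symm)⟩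

theorem top_mem (h : 𝓛.IsDiamond K H L M) : H ⊔ L ∈ 𝓛.carrier := 𝓛.sup_mem h.mem₁ h.mem₂

theorem top_le_normalizer_bot (h : 𝓛.IsDiamond K H L M) :
    H ⊔ L ≤ Subgroup.normalizer (K : Set G) :=
  sup_le (h.covers₁.le_normalizer h.bot_mem) (h.covers₂.le_normalizer h.bot_mem)

theorem top_le_normalizer₁ (h : 𝓛.IsDiamond K H L M) :
    H ⊔ L ≤ Subgroup.normalizer (H : Set G) :=
  (h.covers₂.sup h.mem₁ h.mem₂ h.inf₁₂).le_normalizer h.mem₁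

theorem top_le_normalizer₂ (h : 𝓛.IsDiamond K H L M) :
    H ⊔ L ≤ Subgroup.normalizer (L : Set G) :=
  (sup_comm H L).le.trans h.swap₁₂.top_le_normalizer₁

theorem top_le_normalizer₃ (h : 𝓛.IsDiamond K H L M) :
    H ⊔ L ≤ Subgroup.normalizer (M : Set G) :=
  h.sup₁₃.symm.le.trans h.swap₂₃.top_le_normalizer₂

theorem commutator_mem₁₂ (h : 𝓛.IsDiamond K H L M) {x y : G} (hx : x ∈ H) (hy : y ∈ L) :
    x * y * x⁻¹ * y⁻¹ ∈ K := by
  rw [← h.inf₁₂]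
  refine ⟨?_, L.mul_mem (conj_mem_of_mem_normalizer
    (h.top_le_normalizer₂ (Subgroup.mem_sup_left hx)) hy) (L.inv_mem hy)⟩
  have := mul_mem hx (conj_mem_of_mem_normalizer
    (h.top_le_normalizer₁ (Subgroup.mem_sup_right hy)) (inv_mem hx))
  simpa [mul_assoc] using this

theorem commutator_mem₁ (h : 𝓛.IsDiamond K H L M) {x v : G} (hx : x ∈ H) (hv : v ∈ H ⊔ L) :
    x * v * x⁻¹ * v⁻¹ ∈ K := by
  rw [← h.sup₂₃] at hv
  obtain ⟨y, hy, z, hz, rfl⟩ := (𝓛.permute h.mem₂ h.mem₃).exists_of_mem_sup hv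
  have h1 := h.commutator_mem₁₂ hx hy
  have h2 := h.swap₂₃.commutator_mem₁₂ hx hz
  have h3 := conj_mem_of_mem_normalizer (h.top_le_normalizer_bot (Subgroup.mem_sup_right hy)) h2
  have := mul_mem h1 h3
  convert this using 1
  group

/-- The top of a diamond is abelian modulo its bottom. -/
theorem commutator_mem (h : 𝓛.IsDiamond K H L M) {v w : G} (hv : v ∈ H ⊔ L) (hw : w ∈ H ⊔ L) :
    v * w * v⁻¹ * w⁻¹ ∈ K := by
  obtain ⟨x, hx, y, hy, rfl⟩ := (𝓛.permute h.mem₁ h.mem₂).exists_of_mem_sup hv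
  have h1 := h.commutator_mem₁ hx hw
  have h2 := h.swap₁₂.commutator_mem₁ hy (sup_comm H L ▸ hw)
  have h3 := conj_mem_of_mem_normalizer (h.top_le_normalizer_bot (Subgroup.mem_sup_left hx)) h2
  have := mul_mem h3 h1
  convert this using 1
  group

/-- The case of `isPiNumber_of_lt` in which `W` differs from `H` and `L`: then `W` is a complement of
both, so that `|V : H| = |W : K| = |V : L|` for the top `V`. -/
theorem isPiNumber_of_ne (h : 𝓛.IsDiamond K H L M) {W : Subgroup G} (hW : W ∈ 𝓛.carrier)
    (hKW : K < W) (hWV : W < H ⊔ L) (hWH : W ≠ H) (hWL : W ≠ L) {π : Set Nat.Primes}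
    (hi : IsPiNumber π (K.relIndex W)) : IsPiNumber π (K.relIndex (H ⊔ L)) := by
  have key : ∀ {H L M : Subgroup G}, 𝓛.IsDiamond K H L M → W < H ⊔ L → W ≠ H →
      IsPiNumber π (H.relIndex (H ⊔ L)) := by
    intro H L M h hWV hWH
    have hne : H ⊔ W ≠ H := fun e => by
      have hle : W ≤ H := e ▸ le_sup_right
      rcases h.covers₁.2 W hW hKW.le hle with e | e
      · exact hKW.ne e.symm
      · exact hWH e
    have hcov := h.covers₂.sup h.mem₁ h.mem₂ h.inf₁₂
    have hsup : H ⊔ W = H ⊔ L :=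
      (hcov.2 _ (𝓛.sup_mem h.mem₁ hW) le_sup_left (sup_le le_sup_left hWV.le)).resolve_left hne
    have hinf : H ⊓ W = K := by
      rcases h.covers₁.2 _ (𝓛.inf_mem h.mem₁ hW) (le_inf h.covers₁.1.le hKW.le) inf_le_left
        with e | e
      · exact e
      · exfalso
        rw [sup_eq_right.2 (inf_eq_left.1 e)] at hsup
        exact hWV.ne hsup
    rw [← hsup, sup_comm, (𝓛.permute hW h.mem₁).relIndex_sup, ← Subgroup.inf_relIndex_right, hinf]
    exact hi
  have h1 := key h hWV hWH
  have h2 := key h.swap₁₂ (sup_comm H L ▸ hWV) hWL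
  rw [← Subgroup.relIndex_mul_relIndex K H (H ⊔ L) h.covers₁.1.le le_sup_left]
  refine IsPiNumber.mul ?_ h1
  rw [← h.inf₁₂, inf_comm, Subgroup.inf_relIndex_right, ← (𝓛.permute h.mem₁ h.mem₂).relIndex_sup,
    sup_comm]
  exact h2

/-- If `W` is strictly between the bottom and the top, the index of the bottom in the top has no prime
divisors besides those of `|W : K|`. -/
theorem isPiNumber_of_lt (h : 𝓛.IsDiamond K H L M) {W : Subgroup G} (hW : W ∈ 𝓛.carrier)
    (hKW : K < W) (hWV : W < H ⊔ L) {π : Set Nat.Primes}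
    (hi : IsPiNumber π (K.relIndex W)) : IsPiNumber π (K.relIndex (H ⊔ L)) := by
  have hne : H ≠ L := fun e => by
    have := h.inf₁₂
    rw [e, inf_idem] at this
    exact h.covers₂.1.ne this.symm
  have hne' : L ≠ M := fun e => by
    have := h.inf₂₃
    rw [e, inf_idem] at this
    exact h.covers₃.1.ne this.symm
  have hne'' : H ≠ M := fun e => by
    have := h.inf₁₃
    rw [e, inf_idem] at this
    exact h.covers₃.1.ne this.symm
  by_cases hWH : W = H
  · subst hWH
    rw [← h.sup₂₃]
    exact h.swap₁₂.swap₂₃.isPiNumber_of_ne hW hKW (h.sup₂₃.symm ▸ hWV) hne hne'' hi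
  by_cases hWL : W = L
  · subst hWL
    rw [← h.sup₁₃]
    exact h.swap₂₃.isPiNumber_of_ne hW hKW (h.sup₁₃.symm ▸ hWV) hne.symm hne' hi
  exact h.isPiNumber_of_ne hW hKW hWV hWH hWL hi

end IsDiamond

end PermutingLattice

/-! ### Reduction of diamonds to `s`-subgroups -/

namespace PermutingLattice

variable {G : Type*} [Group G] {σ : Set (Set Nat.Primes)} {𝓛 : PermutingLattice σ G}
  {A B C H K L M : Subgroup G} {s t : Set Nat.Primes}

/-- If the `s`-elements of a member of `𝓛` commute with its `r`-elements for all blocks `r ≠ s`, they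
lie in all distinguished Hall `s`-subgroups. -/
theorem mem_core_of_commute [Finite G] (hσ : Setoid.IsPartition σ) (hC : C ∈ 𝓛.carrier)
    (hs : s ∈ σ)
    (h : ∀ r ∈ σ, r ≠ s → ∀ x ∈ C, ∀ y ∈ C, IsPiNumber s (orderOf x) →
      IsPiNumber r (orderOf y) → x * y = y * x)
    {x : G} (hx : x ∈ C) (hxs : IsPiNumber s (orderOf x)) : x ∈ 𝓛.core s := by
  rw [core, Subgroup.mem_sInf]
  intro T hT
  refine mem_hall_of_commute (𝓛.isHall hT).1 (𝓛.isPiNumber_relIndex hC hs hT) ?_ hx hxs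
  rintro z hz w hw hzs ⟨p, k, hp, hk⟩
  obtain ⟨r, hr, hpr⟩ := exists_block hσ p
  refine h r hr (fun e => hp (e ▸ hpr)) z hz w hw hzs ?_
  rw [hk]
  exact isPiNumber_prime_pow hpr k

/-- If the elements of prime power order of `A` lie in `Z`, then `A ≤ Z`. -/
theorem le_of_forall_mem [Finite G] {Z : Subgroup G} (hσ : Setoid.IsPartition σ)
    (h : ∀ s ∈ σ, ∀ x ∈ A, IsPiNumber s (orderOf x) → x ∈ Z) : A ≤ Z := by
  refine Subgroup.relIndex_eq_one.1 (eq_one_of_forall_not_dvd fun p => not_dvd_relIndex p.2 ?_)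
  intro x hx k hk
  obtain ⟨s, hs, hps⟩ := exists_block hσ p
  exact h s hs x hx (hk ▸ isPiNumber_prime_pow hps k)

/-- If the bottom `K` of a diamond with top `V` has trivial normal core, then
`V = K (V ∩ O_s(G))` for some block `s`. -/
theorem IsDiamond.exists_block_of_core_eq_bot [Finite G] (hσ : Setoid.IsPartition σ)
    (h : 𝓛.IsDiamond K H L M) (hcore : K.normalCore = ⊥) :
    ∃ s ∈ σ, H ⊔ L ≤ K ⊔ ((H ⊔ L) ⊓ 𝓛.core s) := by
  have hKV : K ≤ H ⊔ L := h.covers₁.1.le.trans le_sup_left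
  have hV := h.top_mem
  have hbot : ∀ N : Subgroup G, N.Normal → N ≤ K → N = ⊥ := fun N hN hNK =>
    le_bot_iff.1 (hcore ▸ Subgroup.normal_le_normalCore.2 hNK)
  have hKcomm : ∀ s ∈ σ, ∀ r ∈ σ, r ≠ s → ∀ x ∈ K, ∀ y ∈ K, IsPiNumber s (orderOf x) →
      IsPiNumber r (orderOf y) → x * y = y * x := by
    intro s hs r hr hrs x hx y hy hxs hyr
    have h1 := 𝓛.commutator_mem_normalCore hσ h.bot_mem hs hr hrs.symm hx hy hxs hyr
    rw [hcore, Subgroup.mem_bot, mul_inv_eq_one, mul_inv_eq_iff_eq_mul] at h1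
    exact h1
  -- the normal core `N` of the top is abelian, as its derived subgroup lies in `K`
  let N : Subgroup G := (H ⊔ L).normalCore
  have hNV : N ≤ H ⊔ L := Subgroup.normalCore_le _
  have hNmem : N ∈ 𝓛.carrier := 𝓛.normal_mem _ (Subgroup.normalCore_normal _)
  have hNcomm : ∀ x ∈ N, ∀ y ∈ N, x * y = y * x := by
    have h0 : ⁅N, N⁆ = ⊥ := by
      refine hbot _ (Subgroup.commutator_normal N N) (Subgroup.commutator_le.2 ?_)
      intro x hx y hy
      exact h.commutator_mem (hNV hx) (hNV hy)
    intro x hx y hy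
    have h1 := Subgroup.commutator_mem_commutator hx hy
    rw [h0, Subgroup.mem_bot, commutatorElement_eq_one_iff_mul_comm] at h1
    exact h1
  have hNcore : ∀ s ∈ σ, ∀ x ∈ N, IsPiNumber s (orderOf x) → x ∈ 𝓛.core s :=
    fun s hs x hx hxs => mem_core_of_commute hσ hNmem hs
      (fun _ _ _ x hx y hy _ _ => hNcomm x hx y hy) hx hxs
  -- if `K` contains the `s`-part of `N`, the latter is trivial
  have hNbot : ∀ s ∈ σ, (H ⊔ L) ⊓ 𝓛.core s ≤ K → ∀ x ∈ N, IsPiNumber s (orderOf x) → x = 1 := by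
    intro s hs hle x hx hxs
    have h1 : N ⊓ 𝓛.core s = ⊥ :=
      hbot _ (Subgroup.normal_inf_normal _ _) ((inf_le_inf_right _ hNV).trans hle)
    exact Subgroup.mem_bot.1 (h1 ▸ ⟨hx, hNcore s hs x hx hxs⟩)
  obtain ⟨s, hs, hsK⟩ : ∃ s ∈ σ, ¬ (H ⊔ L) ⊓ 𝓛.core s ≤ K := by
    by_contra hall
    push Not at hall
    have hN : N = ⊥ := le_bot_iff.1 (le_of_forall_mem hσ fun s hs x hx hxs =>
      Subgroup.mem_bot.2 (hNbot s hs (hall s hs) x hx hxs))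
    have hVK : H ⊔ L ≤ K := le_of_forall_mem hσ fun s hs x hx hxs => hall s hs ⟨hx, by
      refine mem_core_of_commute hσ hV hs (fun r hr hrs x hx y hy hxs hyr => ?_) hx hxs
      have h1 := 𝓛.commutator_mem_normalCore hσ hV hs hr hrs.symm hx hy hxs hyr
      change _ ∈ N at h1
      rw [hN, Subgroup.mem_bot, mul_inv_eq_one, mul_inv_eq_iff_eq_mul] at h1
      exact h1⟩
    exact h.covers₁.1.not_ge (le_sup_left.trans hVK)
  refine ⟨s, hs, ?_⟩
  let W := K ⊔ ((H ⊔ L) ⊓ 𝓛.core s)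
  have hcoremem : 𝓛.core s ∈ 𝓛.carrier := 𝓛.normal_mem _ (𝓛.core_normal s)
  have hQ : (H ⊔ L) ⊓ 𝓛.core s ∈ 𝓛.carrier := 𝓛.inf_mem hV hcoremem
  have hW : W ∈ 𝓛.carrier := 𝓛.sup_mem h.bot_mem hQ
  have hWV : W ≤ H ⊔ L := sup_le hKV inf_le_left
  rcases hWV.eq_or_lt with e | hlt
  · exact e.ge
  have hKW : K < W := lt_of_le_of_ne le_sup_left fun e => hsK (e.ge.trans' le_sup_right)
  have hiW : IsPiNumber s (K.relIndex W) := by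
    change IsPiNumber s (K.relIndex (K ⊔ ((H ⊔ L) ⊓ 𝓛.core s)))
    rw [sup_comm, (𝓛.permute hQ h.bot_mem).relIndex_sup]
    exact IsPiNumber.of_dvd ((𝓛.isPiSubgroup_core hs).mono inf_le_right)
      (Subgroup.relIndex_dvd_card _ _)
  have hiV : IsPiNumber s (K.relIndex (H ⊔ L)) := h.isPiNumber_of_lt hW hKW hlt hiW
  -- as `|V : K|` is an `s`-number, the `s'`-elements of `V` lie in `K`
  have hmemK : ∀ x ∈ H ⊔ L, IsPiNumber sᶜ (orderOf x) → x ∈ K := fun x hx hxs =>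
    mem_of_coprime_relIndex (by rw [inf_eq_left.2 hKV]; exact h.top_le_normalizer_bot) hx
      (Nat.Coprime.symm (hiV.coprime hxs))
  have hVcomm : ∀ r ∈ σ, r ≠ s → ∀ x ∈ H ⊔ L, ∀ y ∈ H ⊔ L, IsPiNumber s (orderOf x) →
      IsPiNumber r (orderOf y) → x * y = y * x := by
    intro r hr hrs x hx y hy hxs hyr
    have hrc : r ⊆ sᶜ := block_subset_compl hσ hs hr hrs.symm
    have hyK : y ∈ K := hmemK y hy (hyr.mono hrc)
    have hyO : y ∈ 𝓛.core r :=
      mem_core_of_commute hσ h.bot_mem hr (fun t ht htr => hKcomm r hr t ht htr) hyK hyr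
    -- the commutator is an `r`-element of `N`
    have h1 : x * y * x⁻¹ * y⁻¹ ∈ N :=
      𝓛.commutator_mem_normalCore hσ hV hs hr hrs.symm hx hy hxs hyr
    have h2 : x * y * x⁻¹ * y⁻¹ ∈ 𝓛.core r :=
      mul_mem ((𝓛.core_normal r).conj_mem y hyO x) (inv_mem hyO)
    have hle : (H ⊔ L) ⊓ 𝓛.core r ≤ K := fun z hz =>
      hmemK z hz.1 (((𝓛.isPiSubgroup_core hr).orderOf hz.2).mono hrc)
    have h3 := hNbot r hr hle _ h1 ((𝓛.isPiSubgroup_core hr).orderOf h2)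
    rw [mul_inv_eq_one, mul_inv_eq_iff_eq_mul] at h3
    exact h3
  refine Subgroup.relIndex_eq_one.1 (IsPiNumber.eq_one (π := s)
    (hiV.of_dvd (Subgroup.relIndex_dvd_of_le_left _ le_sup_left))
    (SigmaGroup.isPiNumber_relIndex fun x hx hxs => ?_))
  rw [compl_compl] at hxs
  exact Subgroup.mem_sup_right ⟨hx, mem_core_of_commute hσ hV hs hVcomm hx hxs⟩

/-- The intersection of a diamond with top `V = KQ` with `Q ≤ V` is again a diamond. -/
theorem IsDiamond.inf (h : 𝓛.IsDiamond K H L M) {Q : Subgroup G} (hQ : Q ∈ 𝓛.carrier)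
    (hQV : Q ≤ H ⊔ L) (hVQ : H ⊔ L ≤ K ⊔ Q) :
    𝓛.IsDiamond (K ⊓ Q) (H ⊓ Q) (L ⊓ Q) (M ⊓ Q) := by
  -- the modular law
  have ded : ∀ {X : Subgroup G}, K ≤ X → X ≤ H ⊔ L → X ≤ K ⊔ X ⊓ Q := fun hKX hXV =>
    (le_inf (hXV.trans hVQ) le_rfl).trans (((𝓛.permute h.bot_mem hQ).sup_inf_le hKX).trans
      (by rw [inf_comm Q]))
  have ded' : ∀ {X : Subgroup G}, X ∈ 𝓛.carrier → X ≤ Q → (K ⊔ X) ⊓ Q ≤ X ⊔ K ⊓ Q :=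
    fun hX hXQ => by
      rw [sup_comm]
      exact (𝓛.permute hX h.bot_mem).sup_inf_le hXQ
  have hM : M ≤ H ⊔ L := h.sup₁₃ ▸ le_sup_right
  have cov : ∀ {X : Subgroup G}, X ≤ H ⊔ L → 𝓛.Covers K X → 𝓛.Covers (K ⊓ Q) (X ⊓ Q) := by
    intro X hXV hX
    refine ⟨lt_of_le_of_ne (inf_le_inf_right _ hX.1.le) fun e => ?_, fun U hU hKU hUX => ?_⟩
    · have := ded hX.1.le hXV
      rw [← e, sup_eq_left.2 inf_le_left] at this
      exact hX.1.not_ge this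
    · have hUQ : U ≤ Q := hUX.trans inf_le_right
      rcases hX.2 _ (𝓛.sup_mem h.bot_mem hU) le_sup_left
        (sup_le hX.1.le (hUX.trans inf_le_left)) with e | e
      · exact Or.inl (le_antisymm (le_inf (e ▸ le_sup_right) hUQ) hKU)
      · right
        refine le_antisymm hUX ?_
        rw [← e]
        exact (ded' hU hUQ).trans (sup_le le_rfl hKU)
  have sup : ∀ {X Y : Subgroup G}, X ∈ 𝓛.carrier → Y ∈ 𝓛.carrier → K ≤ X → K ≤ Y →
      X ⊔ Y = H ⊔ L → X ⊓ Q ⊔ Y ⊓ Q = Q := by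
    intro X Y hX hY hKX hKY hXY
    refine le_antisymm (sup_le inf_le_right inf_le_right) ?_
    have h1 : H ⊔ L ≤ K ⊔ (X ⊓ Q ⊔ Y ⊓ Q) := by
      conv_lhs => rw [← hXY]
      refine sup_le ((ded hKX (hXY ▸ le_sup_left)).trans (sup_le_sup_left le_sup_left _))
        ((ded hKY (hXY ▸ le_sup_right)).trans (sup_le_sup_left le_sup_right _))
    refine (le_inf (hQV.trans h1) le_rfl).trans ((ded' (𝓛.sup_mem (𝓛.inf_mem hX hQ)
      (𝓛.inf_mem hY hQ)) (sup_le inf_le_right inf_le_right)).trans (sup_le le_rfl ?_))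
    exact (inf_le_inf_right _ hKX).trans le_sup_left
  have hKH := h.covers₁.1.le
  have hKL := h.covers₂.1.le
  have hKM := h.covers₃.1.le
  have inf : ∀ {X Y : Subgroup G}, X ⊓ Y = K → X ⊓ Q ⊓ (Y ⊓ Q) = K ⊓ Q := fun e => by
    rw [← e]
    exact (inf_inf_distrib_right _ _ _).symm
  have e₁₂ := sup h.mem₁ h.mem₂ hKH hKL rfl
  exact ⟨𝓛.inf_mem h.bot_mem hQ, 𝓛.inf_mem h.mem₁ hQ, 𝓛.inf_mem h.mem₂ hQ, 𝓛.inf_mem h.mem₃ hQ,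
    cov le_sup_left h.covers₁, cov le_sup_right h.covers₂, cov hM h.covers₃,
    inf h.inf₁₂, inf h.inf₁₃, inf h.inf₂₃,
    (sup h.mem₁ h.mem₃ hKH hKM h.sup₁₃).trans e₁₂.symm,
    (sup h.mem₂ h.mem₃ hKL hKM h.sup₂₃).trans e₁₂.symm⟩

/-- Complements `H / K` and `L / K` of the same normal section `M / K` are operator isomorphic:
both are isomorphic to `HM / M = LM / M`. -/
theorem operatorIsomorphic_of_complement {Ω : Subgroup G} (hHM : H ⊓ M = K) (hLM : L ⊓ M = K)
    (hsup : H ⊔ M = L ⊔ M) (hn : H ⊔ M ≤ Subgroup.normalizer (M : Set G))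
    (hH : Ω ≤ Subgroup.normalizer (H : Set G)) (hL : Ω ≤ Subgroup.normalizer (L : Set G))
    (hM : Ω ≤ Subgroup.normalizer (M : Set G)) : OperatorIsomorphic Ω H L K := by
  have conj : ∀ {X : Subgroup G}, Ω ≤ Subgroup.normalizer (X : Set G) → ∀ a ∈ Ω, ∀ x ∈ X,
      a⁻¹ * x * a ∈ X := fun hX a ha x hx => by
    simpa using conj_mem_of_mem_normalizer (inv_mem (hX ha)) hx
  have hK : Ω ≤ Subgroup.normalizer (K : Set G) := hHM ▸ le_normalizer_inf hH hM
  have hMn : (M.subgroupOf (H ⊔ M)).Normal :=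
    ⟨fun m hm g => conj_mem_of_mem_normalizer (A := M) (a := (m : G)) (hn g.2) hm⟩
  have hsec : ∀ {X : Subgroup G}, X ⊓ M = K → X ≤ H ⊔ M →
      Ω ≤ Subgroup.normalizer (X : Set G) → IsOperatorSection Ω X K := by
    intro X hXM hX hXΩ
    refine ⟨hXM ▸ inf_le_left, ⟨fun k hk x => ?_⟩, conj hXΩ, conj hK⟩
    rw [Subgroup.mem_subgroupOf, ← hXM] at hk ⊢
    exact ⟨(x * k * x⁻¹).2, conj_mem_of_mem_normalizer (hn (hX x.2)) hk.2⟩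
  have hHW : H ≤ H ⊔ M := le_sup_left
  have hLW : L ≤ H ⊔ M := hsup ▸ le_sup_left
  have sH := hsec hHM hHW hH
  have sL := hsec hLM hLW hL
  -- the isomorphism `X / K → HM / M`
  have hiso : ∀ {X : Subgroup G}, X ⊓ M = K → X ⊔ M = H ⊔ M → ∀ (hX : X ≤ H ⊔ M)
      (_ : (K.subgroupOf X).Normal), ∃ e : (X ⧸ K.subgroupOf X) ≃* (↥(H ⊔ M) ⧸ M.subgroupOf (H ⊔ M)),
        ∀ x : X, e (QuotientGroup.mk x) = QuotientGroup.mk (Subgroup.inclusion hX x) := by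
    intro X hXM hXsup hX hXn
    have hle : K.subgroupOf X ≤ (M.subgroupOf (H ⊔ M)).comap (Subgroup.inclusion hX) := by
      intro k hk
      rw [Subgroup.mem_subgroupOf, ← hXM] at hk
      exact hk.2
    refine ⟨MulEquiv.ofBijective (QuotientGroup.map _ _ (Subgroup.inclusion hX) hle) ⟨?_, ?_⟩,
      fun x => rfl⟩
    · rw [injective_iff_map_eq_one]
      intro z hz
      obtain ⟨x, rfl⟩ := QuotientGroup.mk_surjective z
      rw [QuotientGroup.map_mk, QuotientGroup.eq_one_iff] at hz
      rw [QuotientGroup.eq_one_iff, Subgroup.mem_subgroupOf, ← hXM]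
      exact ⟨x.2, hz⟩
    · intro z
      obtain ⟨⟨w, hw⟩, rfl⟩ := QuotientGroup.mk_surjective z
      have hp : Permute X M := (permute_of_le_normalizer (hX.trans hn)).symm
      obtain ⟨x, hx, m, hm, e⟩ := hp.exists_of_mem_sup (hXsup.symm ▸ hw)
      refine ⟨QuotientGroup.mk ⟨x, hx⟩, ?_⟩
      rw [QuotientGroup.map_mk, QuotientGroup.eq, Subgroup.mem_subgroupOf]
      simpa [e] using hm
  obtain ⟨eH, heH⟩ := hiso hHM rfl hHW sH.normal
  obtain ⟨eL, heL⟩ := hiso hLM hsup.symm hLW sL.normal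
  have := sH.normal
  have := sL.normal
  refine ⟨sH, sL, eH.trans eL.symm, fun a ha h l hl => ?_⟩
  rw [MulEquiv.trans_apply, MulEquiv.symm_apply_eq, heH, heL, QuotientGroup.eq,
    Subgroup.mem_subgroupOf] at hl ⊢
  have := conj hM a ha _ hl
  simpa [mul_assoc] using this

end PermutingLattice

/-! ### From diamonds to operator isomorphic sections -/

namespace PermutingLattice

variable {G : Type*} [Group G] {σ : Set (Set Nat.Primes)} {𝓛 : PermutingLattice σ G}
  {A B C H K L M : Subgroup G} {s t : Set Nat.Primes}

/-- The `s`-subgroups in a lattice of permuting subgroups are `σ`-permutable, although they are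
only known to permute with the distinguished Hall subgroups. -/
theorem isPermutable_of_mem [Finite G] (hσ : Setoid.IsPartition σ) (hs : s ∈ σ)
    (hA : A ∈ 𝓛.carrier) (hAs : IsPiSubgroup s A) : IsPermutable σ A := by
  have hfull : IsFull σ G := isFull_of_exists_isHall hσ fun t ht =>
    let ⟨T, hT⟩ := 𝓛.hall_nonempty ht
    ⟨T, 𝓛.isHall hT⟩
  have hcore : A ≤ 𝓛.core s := le_sInf fun T hT =>
    (𝓛.isHall hT).le_of_permute hAs (𝓛.permute_hall hA hs hT)
  refine isPermutable_of_isPiSubgroup hσ hfull hs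
    (fun H hH => hcore.trans (hH.le_of_normal (𝓛.isPiSubgroup_core hs))) ?_
  refine upperO_le hσ (X := {T | ∃ t ∈ σ, t ≠ s ∧ T ∈ 𝓛.hall t}) ?_ (fun t ht hts => ?_) ?_
  · rintro g T ⟨t, ht, hts, hT⟩
    exact ⟨t, ht, hts, 𝓛.hall_conj g hT⟩
  · obtain ⟨T, hT⟩ := 𝓛.hall_nonempty ht
    exact ⟨T, ⟨t, ht, hts, hT⟩, 𝓛.isHall hT⟩
  · rintro T ⟨t, ht, hts, hT⟩
    have e : piResidual t A = A := le_antisymm piResidual_le fun x hx =>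
      mem_piResidual hx ((hAs.orderOf hx).mono (block_subset_compl hσ ht hs hts))
    have := 𝓛.hall_le_normalizer_piResidual hA ht hT
    rwa [e] at this

theorem comap_map_mk' {R : Subgroup G} [R.Normal] (h : R ≤ A) :
    (A.map (QuotientGroup.mk' R)).comap (QuotientGroup.mk' R) = A :=
  Subgroup.comap_map_eq_self (by rwa [QuotientGroup.ker_mk'])

/-- Diamonds pass to quotients by normal subgroups contained in their bottom. -/
theorem IsDiamond.map (h : 𝓛.IsDiamond K H L M) {R : Subgroup G} [R.Normal] (hR : R ≤ K) :
    (𝓛.quotient R).IsDiamond (K.map (QuotientGroup.mk' R)) (H.map (QuotientGroup.mk' R))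
      (L.map (QuotientGroup.mk' R)) (M.map (QuotientGroup.mk' R)) := by
  have hinj := Subgroup.comap_injective (QuotientGroup.mk'_surjective R)
  have mem : ∀ {X : Subgroup G}, K ≤ X → X ∈ 𝓛.carrier →
      X.map (QuotientGroup.mk' R) ∈ (𝓛.quotient R).carrier := by
    intro X hKX hX
    change (X.map (QuotientGroup.mk' R)).comap (QuotientGroup.mk' R) ∈ 𝓛.carrier
    rwa [comap_map_mk' (hR.trans hKX)]
  have cov : ∀ {X : Subgroup G}, 𝓛.Covers K X → (𝓛.quotient R).Covers
      (K.map (QuotientGroup.mk' R)) (X.map (QuotientGroup.mk' R)) := by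
    intro X hX
    refine ⟨lt_of_le_of_ne (Subgroup.map_mono hX.1.le) fun e => hX.1.ne ?_, ?_⟩
    · have := congrArg (Subgroup.comap (QuotientGroup.mk' R)) e
      rwa [comap_map_mk' hR, comap_map_mk' (hR.trans hX.1.le)] at this
    · intro C hC hKC hCX
      have h1 := Subgroup.comap_mono (f := QuotientGroup.mk' R) hKC
      have h2 := Subgroup.comap_mono (f := QuotientGroup.mk' R) hCX
      rw [comap_map_mk' hR] at h1
      rw [comap_map_mk' (hR.trans hX.1.le)] at h2
      rcases hX.2 _ hC h1 h2 with e | e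
      · exact Or.inl (hinj (by rw [e, comap_map_mk' hR]))
      · exact Or.inr (hinj (by rw [e, comap_map_mk' (hR.trans hX.1.le)]))
  have inf : ∀ {X Y : Subgroup G}, K ≤ X → K ≤ Y → X ⊓ Y = K →
      X.map (QuotientGroup.mk' R) ⊓ Y.map (QuotientGroup.mk' R) = K.map (QuotientGroup.mk' R) := by
    intro X Y hX hY e
    apply hinj
    rw [Subgroup.comap_inf, comap_map_mk' (hR.trans hX), comap_map_mk' (hR.trans hY),
      comap_map_mk' hR, e]
  have hH := h.covers₁.1.le
  have hL := h.covers₂.1.le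
  have hM := h.covers₃.1.le
  exact ⟨mem le_rfl h.bot_mem, mem hH h.mem₁, mem hL h.mem₂, mem hM h.mem₃, cov h.covers₁,
    cov h.covers₂, cov h.covers₃, inf hH hL h.inf₁₂, inf hH hM h.inf₁₃, inf hL hM h.inf₂₃,
    by rw [← Subgroup.map_sup, ← Subgroup.map_sup, h.sup₁₃],
    by rw [← Subgroup.map_sup, ← Subgroup.map_sup, h.sup₂₃]⟩

end PermutingLattice

section Sufficiency

variable {G : Type*} [Group G] {σ : Set (Set Nat.Primes)}

theorem isModularLattice_of_conditionI [Finite G] (h : ConditionI σ G) :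
    IsModularLattice (PermutableSubgroups σ G) :=
  ⟨fun {A} B C hAC => by
    change ((A ⊔ B) ⊓ C).1 ≤ (A ⊔ B ⊓ C).1
    rw [coe_sup, coe_inf ((A ⊔ B).2.inf C.2 (h _ C)), coe_inf (B.2.inf C.2 (h B C))]
    exact (h A B).sup_inf_le hAC⟩

/-- If `σ`-permutable subgroups permute pairwise and their lattice is not distributive, a diamond
in it yields, in the quotient by the core of its bottom, a diamond of `s`-subgroups for some block
`s`. The atoms of the latter are operator isomorphic modulo its bottom. -/
theorem isDistributive_of_conditionIVCovering [Finite G] (hσ : Setoid.IsPartition σ)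
    (hG : IsFull σ G) (hI : ConditionI σ G) (hIV : ConditionIVCovering σ G) :
    IsDistributive (PermutableSubgroups σ G) := by
  by_contra hnd
  have := isModularLattice_of_conditionI hI
  obtain ⟨k, x, y, z, hx, hy, hz, hxy, hxz, hyz, hxz', hyz'⟩ := exists_diamond hnd
  let 𝓛 := PermutingLattice.ofConditionI hG hI
  have hcov : ∀ {a b : PermutableSubgroups σ G}, a ⋖ b → 𝓛.Covers a.1 b.1 := by
    intro a b hab
    refine ⟨hab.lt, fun C hC haC hCb => ?_⟩
    rcases hab.eq_or_eq (c := ⟨C, hC⟩) haC hCb with e | e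
    · exact Or.inl (congrArg Subtype.val e)
    · exact Or.inr (congrArg Subtype.val e)
  have hinf : ∀ {a b c : PermutableSubgroups σ G}, a ⊓ b = c → a.1 ⊓ b.1 = c.1 := by
    intro a b c e
    rw [← coe_inf (a.2.inf b.2 (hI a b)), e]
  have hd : 𝓛.IsDiamond k.1 x.1 y.1 z.1 := ⟨k.2, x.2, y.2, z.2, hcov hx, hcov hy, hcov hz,
    hinf hxy, hinf hxz, hinf hyz, congrArg Subtype.val hxz', congrArg Subtype.val hyz'⟩
  have hR : k.1.normalCore ≤ k.1 := Subgroup.normalCore_le _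
  have hd' := hd.map hR
  have hf := QuotientGroup.mk'_surjective k.1.normalCore
  have hcore : (k.1.map (QuotientGroup.mk' k.1.normalCore)).normalCore = ⊥ := by
    rw [eq_bot_iff]
    intro q hq
    obtain ⟨g, rfl⟩ := hf q
    have hn : ((k.1.map (QuotientGroup.mk' k.1.normalCore)).normalCore.comap
        (QuotientGroup.mk' k.1.normalCore)).Normal := (Subgroup.normalCore_normal _).comap _
    have hle : (k.1.map (QuotientGroup.mk' k.1.normalCore)).normalCore.comap
        (QuotientGroup.mk' k.1.normalCore) ≤ k.1.normalCore :=
      Subgroup.normal_le_normalCore.2 ((Subgroup.comap_mono (Subgroup.normalCore_le _)).trans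
        (PermutingLattice.comap_map_mk' hR).le)
    exact Subgroup.mem_bot.2 ((QuotientGroup.eq_one_iff g).2 (hle hq))
  obtain ⟨s, hs, hV⟩ := hd'.exists_block_of_core_eq_bot hσ hcore
  have hQ := (𝓛.quotient k.1.normalCore).inf_mem hd'.top_mem
    ((𝓛.quotient k.1.normalCore).normal_mem _
      ((𝓛.quotient k.1.normalCore).core_normal s))
  have hQs : IsPiSubgroup s _ := ((𝓛.quotient k.1.normalCore).isPiSubgroup_core hs).mono
    (inf_le_right (a := x.1.map (QuotientGroup.mk' k.1.normalCore) ⊔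
      y.1.map (QuotientGroup.mk' k.1.normalCore)))
  have hd'' := hd'.inf hQ inf_le_left hV
  have hperm : ∀ {X : Subgroup (G ⧸ k.1.normalCore)}, X ⊓ _ ∈ (𝓛.quotient k.1.normalCore).carrier →
      IsPermutable σ (X ⊓ _) := fun hX =>
    PermutingLattice.isPermutable_of_mem hσ hs hX (hQs.mono inf_le_right)
  have hcov' : ∀ {A B : PermutableSubgroups σ (G ⧸ k.1.normalCore)},
      (𝓛.quotient k.1.normalCore).Covers A.1 B.1 → A ⋖ B := by
    intro A B hAB
    refine ⟨hAB.1, fun C hAC hCB => ?_⟩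
    rcases hAB.2 C.1 (C.2.comap hG hf) hAC.le hCB.le with e | e
    · exact hAC.ne (Subtype.ext e.symm)
    · exact hCB.ne (Subtype.ext e)
  have hn := fun {X : Subgroup (G ⧸ k.1.normalCore)}
      (hX : X ⊓ _ ∈ (𝓛.quotient k.1.normalCore).carrier) =>
    (hperm hX).upperO_le_normalizer hσ hs (hQs.mono inf_le_right)
  have hiso := PermutingLattice.operatorIsomorphic_of_complement (Ω := upperO s) hd''.inf₁₃
    hd''.inf₂₃ (hd''.sup₁₃.trans hd''.sup₂₃.symm)
    (hd''.sup₁₃.le.trans hd''.top_le_normalizer₃) (hn hd''.mem₁) (hn hd''.mem₂) (hn hd''.mem₃)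
  -- the atoms coincide, although they are distinct
  have e := hIV k.1.normalCore s hs ⟨_, hperm hd''.bot_mem⟩ ⟨_, hperm hd''.mem₁⟩
    ⟨_, hperm hd''.mem₂⟩ (hQs.mono inf_le_right) (hQs.mono inf_le_right) (hQs.mono inf_le_right)
    (hcov' hd''.covers₁) (hcov' hd''.covers₂) hiso
  have h12 := hd''.inf₁₂
  rw [Subtype.mk.inj e, inf_idem] at h12
  exact hd''.covers₂.1.ne h12.symm

end Sufficiency

end SigmaGroup

theorem theoremA {G : Type*} [Group G] [Finite G]
    (σ : Set (Set Nat.Primes)) (hσ : Setoid.IsPartition σ)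
    (hG : SigmaGroup.IsFull σ G) :
    (SigmaGroup.IsDistributive (SigmaGroup.PermutableSubgroups σ G) ↔
      SigmaGroup.ConditionI σ G ∧ SigmaGroup.ConditionII G ∧
      SigmaGroup.ConditionIII σ G ∧ SigmaGroup.ConditionIV σ G) ∧
    (SigmaGroup.ConditionI σ G ∧ SigmaGroup.ConditionII G ∧
      SigmaGroup.ConditionIII σ G ∧ SigmaGroup.ConditionIVCovering σ G →
      SigmaGroup.IsDistributive (SigmaGroup.PermutableSubgroups σ G)) := by
  refine ⟨⟨fun h => ⟨SigmaGroup.permute_of_isDistributive h,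
    SigmaGroup.conditionII_of_isDistributive hG h,
    SigmaGroup.conditionIII_of_isDistributive hσ hG h,
    SigmaGroup.conditionIV_of_isDistributive hσ hG h⟩, fun h => ?_⟩, fun h => ?_⟩
  · exact SigmaGroup.isDistributive_of_conditionIVCovering hσ hG h.1
      fun R _ s hs K H L hK hH hL _ _ => h.2.2.2 R s hs K H L hK hH hL
  · exact SigmaGroup.isDistributive_of_conditionIVCovering hσ hG h.1 h.2.2.2
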